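/- **Data.** Let $\mathcal X=\{x\in\mathbb R^{n_1}_+ : x_i\in\{0,1\}\ \forall i\in\mathcal I\}$ with $\mathcal I\subseteq\{1,\dots,n_1\}$, and let $c_x,c_y,G_{xy},G_y,h_y,d,A,B,b$ be real matrices and vectors of matching dimensions: $y\in\mathbb R^{n_2}$, $A$ and $B$ have $m$ rows, $G_{xy}$ and $G_y$ have $p$ rows. They describe the mixed-integer bilevel problem $\min c_x^Tx+c_y^Ty$ s.t. $G_{xy}x+G_yy\ge h_y$, $x\in\mathcal X$, $y\in\arg\min_{y\ge0}\{d^Ty: Ax+By\ge b\}$. Let $\overline\psi\in\mathbb R^m$ be the vector used as upper bound on $\psi\in\mathbb R^m_+$. Let $K_\psi\psi+K_ss\ge k+K_xx$ be the system of McCormick inequalities for the equations $s_{ji}=A_{ji}\psi_jx_i$ ($1\le j\le m$, $i\in\mathcal I$): for every pair $(j,i)$, with $l_{ji}=\min(0,A_{ji}\overline\psi_j)$ and $u_{ji}=\max(0,A_{ji}\overline\psi_j)$, $$s_{ji}\ge l_{ji}x_i,\quad s_{ji}\ge A_{ji}\psi_j+u_{ji}x_i-u_{ji},\quad s_{ji}\le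 u_{ji}x_i,\quad s_{ji}\le A_{ji}\psi_j+l_{ji}x_i-l_{ji}.$$ **Problem (MIP)** is $\min_{x\in\mathcal X}c_x^Tx+f(x)$, where $$f(x)=\min\Big\{c_y^Ty:\ G_yy\ge h_y-G_{xy}x,\ By\ge b-Ax,\ B^T\psi\le d,\ d^Ty\le b^T\psi-\mathbf 1^Ts,\ K_\psi\psi+K_ss\ge k+K_xx,\ y,\psi,s\ge0\Big\},$$ with $f(x)=+\infty$ if this linear program is infeasible. **Assumptions.** (a) The $i$-th column of $A$ is zero for every $i\notin\mathcal I$. (b) The problem $\min\{c_x^Tx+c_y^Ty: x\in\mathcal X,\ y\ge0,\ G_{xy}x+G_yy\ge h_y,\ Ax+By\ge b\}$ is feasible and bounded below. **Polyhedra.** Let $$P_1=\{(y,v)\ge0:\ By-K_\psi^Tv\ge b,\ K_s^Tv\le\mathbf 1\},\qquad P_2=\{(\psi,u_y,w)\ge0:\ B^T\psi+G_y^Tu_y\le dw+c_y\},$$ and let $\mathcal J_1,\mathcal J_2$ be their sets of extreme points and $\mathcal R_1,\mathcal R_2$ their sets of extreme rays (nonzero vectors that span an extreme ray of the recession cone).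 The Benders subproblem at $x$, i.e. the dual of the linear program that defines $f(x)$, maximizes $\psi^T(b-Ax)+u_y^T(h_y-G_{xy}x)-\left[d^Ty-v^T(k+K_xx)\right]$ over $$P=\{(\psi,u_y,w,y,v)\ge0:\ By-K_\psi^Tv\ge bw,\ B^T\psi+G_y^Tu_y\le dw+c_y,\ K_s^Tv\le\mathbf 1w\}.$$ **Claim.** Problem (MIP) is equivalent to the master problem $$\begin{aligned}\min_{x\in\mathcal X,\,t\in\mathbb R}\quad& c_x^Tx+t\\ \text{s.t.}\quad& t\ge\hat\psi^T(b-Ax)+\hat u_y^T(h_y-G_{xy}x)-\hat w\left(d^T\hat y-\hat v^T(k+K_xx)\right)&&\forall(\hat\psi,\hat u_y,\hat w)\in\mathcal J_2,\ (\hat y,\hat v)\in\mathcal J_1,\\& d^T\tilde y-\tilde v^T(k+K_xx)\ge0&&\forall(\tilde y,\tilde v)\in\mathcal R_1,\\& 0\ge\tilde\psi^T(b-Ax)+\tilde u_y^T(h_y-G_{xy}x)&&\forall(\tilde\psi,\tilde u_y,0)\in\mathcal R_2,\\& 0\ge\tilde\psi^T(b-Ax)+\tilde u_y^T(h_y-G_{xy}x)-\tilde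 w\left(d^T\hat y-\hat v^T(k+K_xx)\right)&&\forall(\hat y,\hat v)\in\mathcal J_1,\ (\tilde\psi,\tilde u_y,\tilde w)\in\mathcal R_2,\ \tilde w>0.\end{aligned}$$ That is: $(x,t)$ is feasible for the master problem if and only if $x\in\mathcal X$ and $f(x)\le t$, where the minimum $f(x)$ is attained whenever it is not $+\infty$; the two problems have the same optimal value; and $(x,t)$ is optimal for the master problem if and only if $x$ is optimal for (MIP) and $t=f(x)$. Moreover, the extreme points of $P$ are exactly the vectors $(\hat\psi,\hat u_y,\hat w,\hat w\hat y,\hat w\hat v)$ with $(\hat\psi,\hat u_y,\hat w)\in\mathcal J_2$ and $(\hat y,\hat v)\in\mathcal J_1$, and the extreme rays of $P$ are exactly the vectors $(0,0,0,\tilde y,\tilde v)$ with $(\tilde y,\tilde v)\in\mathcal R_1$, $(\tilde\psi,\tilde u_y,0,0,0)$ with $(\tilde\psi,\tilde u_y,0)\in\mathcal R_2$, and $(\tilde\psi,\tilde u_y,\tilde w,\tilde w\hat y,\tilde w\hat v)$ with $(\hat y,\hat v)\in\mathcal J_1$, $(\tilde\psi,\tilde u_y,\tilde w)\in\mathcal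 R_2$ and $\tilde w>0$. -/

import Mathlib

open Matrix

/-- The recession cone of a set `S`: the directions along which one never leaves `S`. -/
def recessionCone {E : Type*} [AddCommGroup E] [Module ℝ E] (S : Set E) : Set E :=
  {r | ∀ z ∈ S, ∀ t : ℝ, 0 ≤ t → z + t • r ∈ S}

/-- The nonzero vectors that span an extreme ray of (the recession cone of) `S`. All positive
multiples of such a vector are included. -/
def extremeRays {E : Type*} [AddCommGroup E] [Module ℝ E] (S : Set E) : Set E :=
  {r | r ∈ recessionCone S ∧ r ≠ 0 ∧
    ∀ r₁ ∈ recessionCone S, ∀ r₂ ∈ recessionCone S, r₁ + r₂ = r →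
      (∃ t : ℝ, 0 ≤ t ∧ r₁ = t • r) ∧ (∃ t : ℝ, 0 ≤ t ∧ r₂ = t • r)}

/-- Data of a mixed-integer linear bilevel problem
`min c_x x + c_y y` s.t. `G_xy x + G_y y ≥ h_y`, `x ≥ 0`, `x_i ∈ {0,1}` for `i ∈ I`,
`y ∈ argmin {d y : A x + B y ≥ b, y ≥ 0}`, with `n₁` leader and `n₂` follower variables,
`m` follower constraints and `p` leader constraints, together with the upper bound `psiBar` for the
follower's dual variables that is used in the linearization. -/
structure Bilevel (n₁ n₂ m p : ℕ) where
  /-- indices of the binary leader variables -/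
  I : Finset (Fin n₁)
  cx : Fin n₁ → ℝ
  cy : Fin n₂ → ℝ
  Gxy : Matrix (Fin p) (Fin n₁) ℝ
  Gy : Matrix (Fin p) (Fin n₂) ℝ
  hy : Fin p → ℝ
  d : Fin n₂ → ℝ
  A : Matrix (Fin m) (Fin n₁) ℝ
  B : Matrix (Fin m) (Fin n₂) ℝ
  b : Fin m → ℝ
  psiBar : Fin m → ℝ

namespace Bilevel

variable {n₁ n₂ m p : ℕ} (D : Bilevel n₁ n₂ m p)

/-- The set `𝒳` of leader decisions. -/
def X : Set (Fin n₁ → ℝ) := {x | 0 ≤ x ∧ ∀ i ∈ D.I, x i = 0 ∨ x i = 1}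

/-- The follower's optimality is relaxed to feasibility: feasible set of
`min c_x x + c_y y` s.t. `x ∈ 𝒳`, `y ≥ 0`, `G_xy x + G_y y ≥ h_y`, `A x + B y ≥ b`. -/
def lowerBoundFeasible : Set ((Fin n₁ → ℝ) × (Fin n₂ → ℝ)) :=
  {q | q.1 ∈ D.X ∧ 0 ≤ q.2 ∧ D.hy ≤ D.Gxy *ᵥ q.1 + D.Gy *ᵥ q.2 ∧
    D.b ≤ D.A *ᵥ q.1 + D.B *ᵥ q.2}

/-- The index set of the linearized products `s_{ji} = A_{ji} ψ_j x_i`, `i ∈ I`. -/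
abbrev Pair : Type := Fin m × {i : Fin n₁ // i ∈ D.I}

/-- The index set of the McCormick inequalities: four for every product. -/
abbrev McRow : Type := Fin 4 × D.Pair

/-- Smaller end of the range of `A_{ji} ψ_j` for `0 ≤ ψ_j ≤ psiBar_j`. -/
noncomputable def lo (q : D.Pair) : ℝ := min 0 (D.A q.1 q.2 * D.psiBar q.1)

/-- Larger end of the range of `A_{ji} ψ_j` for `0 ≤ ψ_j ≤ psiBar_j`. -/
noncomputable def hi (q : D.Pair) : ℝ := max 0 (D.A q.1 q.2 * D.psiBar q.1)

/-! The system `Kpsi ψ + Ks s ≥ k + Kx x` consists of the McCormick inequalities of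
`s = (a ψ) x`, where `a = A_{ji}`, `a ψ ∈ [lo, hi]` and `x ∈ [0, 1]`:
`s ≥ lo x`, `s ≥ a ψ + hi x - hi`, `s ≤ hi x`, `s ≤ a ψ + lo x - lo`. -/

def Kpsi : Matrix D.McRow (Fin m) ℝ := fun r j =>
  if j = r.2.1 then ![0, -D.A r.2.1 r.2.2, 0, D.A r.2.1 r.2.2] r.1 else 0

def Ks : Matrix D.McRow D.Pair ℝ := fun r q =>
  if q = r.2 then ![1, 1, -1, -1] r.1 else 0

noncomputable def Kx : Matrix D.McRow (Fin n₁) ℝ := fun r i =>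
  if i = r.2.2 then ![D.lo r.2, D.hi r.2, -D.hi r.2, -D.lo r.2] r.1 else 0

noncomputable def k : D.McRow → ℝ := fun r => ![0, -D.hi r.2, 0, D.lo r.2] r.1

/-- Feasible points `(y, ψ, s)` of the inner problem of (MIP) at `x`. -/
def inner (x : Fin n₁ → ℝ) : Set ((Fin n₂ → ℝ) × (Fin m → ℝ) × (D.Pair → ℝ)) :=
  {z | match z with
    | (y, ψ, s) =>
      D.hy - D.Gxy *ᵥ x ≤ D.Gy *ᵥ y ∧
      D.b - D.A *ᵥ x ≤ D.B *ᵥ y ∧ 0 ≤ y ∧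
      -D.d ≤ -(ψ ᵥ* D.B) ∧ 0 ≤ ψ ∧
      0 ≤ -(D.d ⬝ᵥ y) + ψ ⬝ᵥ D.b - s ⬝ᵥ 1 ∧
      D.k + D.Kx *ᵥ x ≤ D.Kpsi *ᵥ ψ + D.Ks *ᵥ s ∧ 0 ≤ s}

/-- The value `f(x)` of the inner problem, `⊤` if it is infeasible. -/
noncomputable def f (x : Fin n₁ → ℝ) : EReal :=
  ⨅ z ∈ D.inner x, ((D.cy ⬝ᵥ z.1 : ℝ) : EReal)

/-- Objective of (MIP), which is to be minimized over `x ∈ 𝒳`. -/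
noncomputable def mipObj (x : Fin n₁ → ℝ) : EReal := ((D.cx ⬝ᵥ x : ℝ) : EReal) + D.f x

/-- Feasible set of the Benders subproblem, the dual of the inner problem; points are
`(ψ, u_y, w, y, v)`. -/
def dualSet :
    Set ((Fin m → ℝ) × (Fin p → ℝ) × ℝ × (Fin n₂ → ℝ) × (D.McRow → ℝ)) :=
  {μ | match μ with
    | (ψ, u, w, y, v) =>
      w • D.b ≤ D.B *ᵥ y - D.Kpsiᵀ *ᵥ v ∧
      D.Bᵀ *ᵥ ψ + D.Gyᵀ *ᵥ u ≤ w • D.d + D.cy ∧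
      D.Ksᵀ *ᵥ v ≤ w • 1 ∧
      0 ≤ ψ ∧ 0 ≤ u ∧ 0 ≤ w ∧ 0 ≤ y ∧ 0 ≤ v}

/-- Feasible set of the lower-level related problem; points are `(y, v)`. -/
def set₁ : Set ((Fin n₂ → ℝ) × (D.McRow → ℝ)) :=
  {q | match q with
    | (y, v) =>
      D.b ≤ D.B *ᵥ y - D.Kpsiᵀ *ᵥ v ∧ D.Ksᵀ *ᵥ v ≤ 1 ∧ 0 ≤ y ∧ 0 ≤ v}

/-- Feasible set of the upper-level related problem; points are `(ψ, u_y, w)`. -/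
def set₂ : Set ((Fin m → ℝ) × (Fin p → ℝ) × ℝ) :=
  {q | match q with
    | (ψ, u, w) => D.Bᵀ *ᵥ ψ + D.Gyᵀ *ᵥ u ≤ w • D.d + D.cy ∧ 0 ≤ ψ ∧ 0 ≤ u ∧ 0 ≤ w}

def J₁ : Set ((Fin n₂ → ℝ) × (D.McRow → ℝ)) := D.set₁.extremePoints ℝ

def R₁ : Set ((Fin n₂ → ℝ) × (D.McRow → ℝ)) := extremeRays D.set₁

def J₂ : Set ((Fin m → ℝ) × (Fin p → ℝ) × ℝ) := D.set₂.extremePoints ℝ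

def R₂ : Set ((Fin m → ℝ) × (Fin p → ℝ) × ℝ) := extremeRays D.set₂

/-- Objective of the lower-level related problem at `x`. -/
noncomputable def obj₁ (x : Fin n₁ → ℝ) (y : Fin n₂ → ℝ) (v : D.McRow → ℝ) : ℝ :=
  D.d ⬝ᵥ y - v ⬝ᵥ (D.k + D.Kx *ᵥ x)

/-- The part of the subproblem's objective at `x` that depends on `ψ` and `u_y`. -/
def obj₂ (x : Fin n₁ → ℝ) (ψ : Fin m → ℝ) (u : Fin p → ℝ) : ℝ :=
  ψ ⬝ᵥ (D.b - D.A *ᵥ x) + u ⬝ᵥ (D.hy - D.Gxy *ᵥ x)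

/-- Feasible set of the Benders master problem `min c_x x + t`; points are `(x, t)`. -/
def master : Set ((Fin n₁ → ℝ) × ℝ) :=
  {q | match q with
    | (x, t) =>
      x ∈ D.X ∧
      (∀ ψ u w, (ψ, u, w) ∈ D.J₂ → ∀ y v, (y, v) ∈ D.J₁ →
        D.obj₂ x ψ u - w * D.obj₁ x y v ≤ t) ∧
      (∀ y v, (y, v) ∈ D.R₁ → 0 ≤ D.obj₁ x y v) ∧
      (∀ ψ u, (ψ, u, (0 : ℝ)) ∈ D.R₂ → D.obj₂ x ψ u ≤ 0) ∧
      (∀ y v, (y, v) ∈ D.J₁ → ∀ ψ u w, (ψ, u, w) ∈ D.R₂ → 0 < w →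
        D.obj₂ x ψ u - w * D.obj₁ x y v ≤ 0)}

end Bilevel

/-! The blocks of the Benders subproblem are coupled only through `w`: `(ψ, u, w)` ranges freely
over `P₂`, and then `(y, v)` ranges over `w P₁`, which has to be read as the recession cone of `P₁`
when `w = 0`. Homogenization treats both cases alike. If `C₁` is the closed cone whose slice at
height one is `P₁` and whose slice at height zero is its recession cone, the coupling reads `((y,
v), w) ∈ C₁`.

This determines the extreme structure of `P`. If `w > 0`, one divides `(y, v)` by `w` and varies one
block with the other held fixed. If `w = 0`, an extreme point must have `(y, v) = 0`, and an extreme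
ray, being one of a product of two pointed cones, lies in a single factor
(`extremePoints_coupledCone`, `extremeRays_coupledCone`).

Linear programming duality (`weak_duality`, and `strong_duality` from Farkas' lemma) says that `f x
≤ t` exactly when the subproblem's objective is at most `t` on `P`. The sign constraints exclude
lines from `P`, so this can be tested by the bound `t` at extreme points and `0` on extreme rays
(`IsHomogenization.forall_le_iff`). Inserting the description of these gives the master constraints.

The assumptions serve to make `P₁` and `P₂` nonempty: a feasible point of the relaxation yields a
point of `P₁`, and boundedness yields, by Farkas, a point of `P₂` with `w = 0`. -/

/-! ### Farkas' lemma, linear and affine -/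

/-- **Farkas' lemma** for finitely many linear functionals on a real vector space. -/
theorem farkas_functionals {V ι : Type*} [AddCommGroup V] [Module ℝ V] (s : Finset ι)
    (a : ι → V →ₗ[ℝ] ℝ) (g : V →ₗ[ℝ] ℝ)
    (h : ∀ x, (∀ i ∈ s, 0 ≤ a i x) → 0 ≤ g x) :
    ∃ c : ι → ℝ, (∀ i, 0 ≤ c i) ∧ ∀ x, g x = ∑ i ∈ s, c i * a i x := by
  classical
  induction s using Finset.induction_on generalizing a g with
  | empty =>
    refine ⟨0, fun _ => le_rfl, fun x => ?_⟩
    have h1 := h x (by simp)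
    have h2 := h (-x) (by simp)
    rw [map_neg] at h2
    simp only [Finset.sum_empty]
    linarith
  | insert j s hj ih =>
    by_cases hs : ∀ x, (∀ i ∈ s, 0 ≤ a i x) → 0 ≤ g x
    · obtain ⟨c, hc, hg⟩ := ih a g hs
      refine ⟨Function.update c j 0, fun i => ?_, fun x => ?_⟩
      · by_cases hij : i = j
        · subst hij; simp
        · simpa [hij] using hc i
      · rw [Finset.sum_insert hj, hg x]
        simp only [Function.update_self, zero_mul, zero_add]
        refine Finset.sum_congr rfl fun i hi => ?_
        rw [Function.update_of_ne (ne_of_mem_of_not_mem hi hj)]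
    · push Not at hs
      obtain ⟨y, hy, hgy⟩ := hs
      have hay : a j y < 0 := by
        by_contra hcon
        push Not at hcon
        refine absurd (h y fun i hi => ?_) (not_le.2 hgy)
        rcases Finset.mem_insert.1 hi with rfl | hi
        · exact hcon
        · exact hy i hi
      -- With `a j z = -1`, the map `x ↦ x + a j x • z` is a projection onto the kernel of `a j`.
      -- The induction hypothesis is applied to the functionals composed with it.
      obtain ⟨z, hz, hgz, haz⟩ : ∃ z, (∀ i ∈ s, 0 ≤ a i z) ∧ g z < 0 ∧ a j z = -1 := by
        refine ⟨(-(a j y))⁻¹ • y, fun i hi => ?_, ?_, ?_⟩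
        · rw [map_smul, smul_eq_mul]
          exact mul_nonneg (inv_nonneg.2 (by linarith)) (hy i hi)
        · rw [map_smul, smul_eq_mul]
          exact mul_neg_of_pos_of_neg (inv_pos.2 (by linarith)) hgy
        · rw [map_smul, smul_eq_mul]
          rw [inv_neg, neg_mul, inv_mul_cancel₀ hay.ne]
      obtain ⟨c, hc, hg⟩ := ih (fun i => a i + (a i z) • a j) (g + (g z) • a j) (by
        intro x hx
        have := h (x + (a j x) • z) (fun i hi => by
          rcases Finset.mem_insert.1 hi with rfl | hi
          · simp [haz]
          · have := hx i hi
            simp only [LinearMap.add_apply, LinearMap.smul_apply, smul_eq_mul] at this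
            simp only [map_add, map_smul, smul_eq_mul]
            linarith)
        simp only [map_add, map_smul, smul_eq_mul] at this
        simp only [LinearMap.add_apply, LinearMap.smul_apply, smul_eq_mul]
        linarith)
      -- Solving the identity for `g` leaves this coefficient on `a j`; it is nonnegative since `a i
      -- z ≥ 0` on `s` and `g z < 0`.
      refine ⟨Function.update c j (∑ i ∈ s, c i * a i z - g z), fun i => ?_, fun x => ?_⟩
      · by_cases hij : i = j
        · subst hij
          have : 0 ≤ ∑ i ∈ s, c i * a i z := Finset.sum_nonneg fun i hi => mul_nonneg (hc i) (hz i hi)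
          simp only [Function.update_self]
          linarith
        · simpa [hij] using hc i
      · rw [Finset.sum_insert hj]
        have h1 : ∑ i ∈ s, Function.update c j (∑ i ∈ s, c i * a i z - g z) i * a i x
            = ∑ i ∈ s, c i * a i x := Finset.sum_congr rfl fun i hi => by
          rw [Function.update_of_ne (ne_of_mem_of_not_mem hi hj)]
        have h2 := hg x
        simp only [LinearMap.add_apply, LinearMap.smul_apply, smul_eq_mul, mul_add,
          Finset.sum_add_distrib, ← mul_assoc, ← Finset.sum_mul] at h2
        rw [h1, Function.update_self]
        linarith

/-- The affine form of Farkas' lemma: a linear functional that is bounded by `t` on a nonempty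
polyhedron is bounded by a nonnegative combination of the constraints. -/
theorem affine_farkas {V ι : Type*} [AddCommGroup V] [Module ℝ V] [Fintype ι]
    (a : ι → V →ₗ[ℝ] ℝ) (c : ι → ℝ) (g : V →ₗ[ℝ] ℝ) (t : ℝ)
    (hne : ∃ x, ∀ i, a i x ≤ c i) (h : ∀ x, (∀ i, a i x ≤ c i) → g x ≤ t) :
    ∃ l : ι → ℝ, (∀ i, 0 ≤ l i) ∧ (∀ x, g x = ∑ i, l i * a i x) ∧ ∑ i, l i * c i ≤ t := by
  obtain ⟨z, hz⟩ := hne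
  -- Homogenize: on `s ≥ 0` and `a i x ≤ c i * s`, the claim becomes `g x ≤ t * s`.
  let a' : Option ι → (V × ℝ) →ₗ[ℝ] ℝ := fun o => o.elim (LinearMap.snd ℝ V ℝ)
    fun i => c i • LinearMap.snd ℝ V ℝ - a i ∘ₗ LinearMap.fst ℝ V ℝ
  obtain ⟨l, hl, hg⟩ := farkas_functionals Finset.univ a'
      (t • LinearMap.snd ℝ V ℝ - g ∘ₗ LinearMap.fst ℝ V ℝ) (by
    rintro ⟨x, s⟩ hx
    have hs : 0 ≤ s := hx none (Finset.mem_univ _)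
    have hx' : ∀ i, a i x ≤ c i * s := fun i => by
      simpa [a'] using hx (some i) (Finset.mem_univ _)
    suffices g x ≤ t * s by simpa using this
    -- At `s = 0` the vector `x` is a recession direction, and `g x > 0` would make `g` unbounded
    -- along the ray from `z`. For `s > 0` one rescales to height one.
    rcases hs.eq_or_lt with rfl | hs
    · by_contra hcon
      push Not at hcon
      rw [mul_zero] at hcon
      obtain ⟨k, hk0, hk⟩ : ∃ k : ℝ, 0 ≤ k ∧ t < g z + k * g x := by
        refine ⟨(|t - g z| + 1) / g x, by positivity, ?_⟩
        rw [div_mul_cancel₀ _ hcon.ne']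
        have := le_abs_self (t - g z)
        linarith
      have := h (z + k • x) fun i => by
        have h1 := hz i
        have h2 := mul_nonneg hk0 (neg_nonneg.2 ((hx' i).trans_eq (mul_zero _)))
        rw [map_add, map_smul, smul_eq_mul]
        linarith
      rw [map_add, map_smul, smul_eq_mul] at this
      linarith
    · have := h (s⁻¹ • x) fun i => by
        rw [map_smul, smul_eq_mul, inv_mul_le_iff₀ hs, mul_comm]
        exact hx' i
      rwa [map_smul, smul_eq_mul, inv_mul_le_iff₀ hs, mul_comm] at this)
  refine ⟨fun i => l (some i), fun i => hl _, fun x => ?_, ?_⟩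
  · have := hg (x, 0)
    simp only [Fintype.sum_option, a'] at this
    simpa [Finset.sum_neg_distrib] using this
  · have := hg (0, 1)
    simp only [Fintype.sum_option, a'] at this
    simp at this
    have := hl none
    linarith

/-! ### Cones and their slices at height one and zero -/

section Homogenization

variable {E : Type*} [AddCommGroup E] [Module ℝ E]

/-- The points at height one of a cone in `E × ℝ`. -/
def heightOne (C : PointedCone ℝ (E × ℝ)) : Set E := {x | (x, (1 : ℝ)) ∈ C}

variable {C : PointedCone ℝ (E × ℝ)}

theorem inv_smul_mem_heightOne {x : E} {s : ℝ} (h : (x, s) ∈ C) (hs : 0 < s) :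
    s⁻¹ • x ∈ heightOne C := by
  have := C.smul_mem (inv_nonneg.2 hs.le) h
  rwa [Prod.smul_mk, smul_eq_mul, inv_mul_cancel₀ hs.ne'] at this

theorem smul_mem_of_mem_heightOne {x : E} (h : x ∈ heightOne C) {s : ℝ} (hs : 0 ≤ s) :
    (s • x, s) ∈ C := by
  have := C.smul_mem hs h
  rwa [Prod.smul_mk, smul_eq_mul, mul_one] at this

theorem add_mem_heightOne {x r : E} (h : x ∈ heightOne C) (hr : (r, (0 : ℝ)) ∈ C) :
    x + r ∈ heightOne C := by
  have := C.add_mem h hr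
  rwa [Prod.mk_add_mk, add_zero] at this

theorem smul_recession_mem {r : E} (hr : (r, (0 : ℝ)) ∈ C) {t : ℝ} (ht : 0 ≤ t) :
    (t • r, (0 : ℝ)) ∈ C := by
  have := C.smul_mem ht hr
  rwa [Prod.smul_mk, smul_zero] at this

end Homogenization

/-! ### Pointed closed cones: recession directions, extreme points and rays -/

section Normed

variable {E : Type*} [NormedAddCommGroup E] [NormedSpace ℝ E]

/-- `C` is the closed homogenization of a set on whose directions the linear functional `σ`
dominates the norm. -/
structure IsHomogenization (C : PointedCone ℝ (E × ℝ)) (σ : E →ₗ[ℝ] ℝ) : Prop where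
  closed : IsClosed (C : Set (E × ℝ))
  height_nonneg : ∀ z ∈ C, 0 ≤ z.2
  norm_le : ∀ z ∈ C, ‖z.1‖ ≤ σ z.1

variable {C : PointedCone ℝ (E × ℝ)} {σ : E →ₗ[ℝ] ℝ}

namespace IsHomogenization

theorem nonneg (hC : IsHomogenization C σ) {z : E × ℝ} (hz : z ∈ C) : 0 ≤ σ z.1 :=
  (norm_nonneg _).trans (hC.norm_le z hz)

theorem eq_zero (hC : IsHomogenization C σ) {z : E × ℝ} (hz : z ∈ C) (h : σ z.1 ≤ 0) :
    z.1 = 0 :=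
  norm_le_zero_iff.1 ((hC.norm_le z hz).trans h)

theorem eq_zero_of_add (hC : IsHomogenization C σ) {z z' : E × ℝ} (hz : z ∈ C) (hz' : z' ∈ C)
    (h : z.1 + z'.1 = 0) : z.1 = 0 ∧ z'.1 = 0 := by
  have h0 : σ z.1 + σ z'.1 = 0 := by rw [← map_add, h, map_zero]
  have h1 := hC.nonneg hz
  have h2 := hC.nonneg hz'
  exact ⟨hC.eq_zero hz (by linarith), hC.eq_zero hz' (by linarith)⟩

/-- If `r` is a recession direction, `z + (n + 1) • r` stays in the slice. Dividing by `n + 1` gives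
points of `C` that tend to `(r, 0)`, and `C` is closed. -/
theorem mem_recessionCone (hC : IsHomogenization C σ) (hne : (heightOne C).Nonempty) {r : E} :
    r ∈ recessionCone (heightOne C) ↔ (r, (0 : ℝ)) ∈ C := by
  refine ⟨fun hr => ?_, fun hr z hz t ht => add_mem_heightOne hz (smul_recession_mem hr ht)⟩
  obtain ⟨z, hz⟩ := hne
  have hlim : Filter.Tendsto (fun n : ℕ => ((1 / ((n : ℝ) + 1)) • z + r, 1 / ((n : ℝ) + 1)))
      Filter.atTop (nhds (r, (0 : ℝ))) := by
    have h0 := tendsto_one_div_add_atTop_nhds_zero_nat (𝕜 := ℝ)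
    refine Filter.Tendsto.prodMk_nhds ?_ h0
    simpa using (h0.smul_const z).add_const r
  refine hC.closed.mem_of_tendsto hlim (Filter.Eventually.of_forall fun n => ?_)
  have hn : (0 : ℝ) < n + 1 := by positivity
  have := smul_mem_of_mem_heightOne (hr z hz (n + 1) hn.le) (one_div_nonneg.2 hn.le)
  rwa [smul_add, smul_smul, one_div_mul_cancel hn.ne', one_smul] at this

/-- A linear functional that is at most `t` at the extreme points and nonpositive on the extreme
rays is at most `t` everywhere. -/
theorem le_of_extreme [FiniteDimensional ℝ E] (hC : IsHomogenization C σ) (g : E →ₗ[ℝ] ℝ) (t : ℝ)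
    (hp : ∀ x ∈ (heightOne C).extremePoints ℝ, g x ≤ t)
    (hr : ∀ r ∈ extremeRays (heightOne C), g r ≤ 0) {x : E} (hx : x ∈ heightOne C) : g x ≤ t := by
  have hne : (heightOne C).Nonempty := ⟨x, hx⟩
  -- `τ` is positive on `C` away from zero, since `σ` dominates the norm and heights are
  -- nonnegative. Hence `K`, the slice `τ = 1`, is a compact convex base of `C`, and the claim
  -- becomes `G ≤ 0` on `K`.
  let τ : E × ℝ →ₗ[ℝ] ℝ := σ ∘ₗ LinearMap.fst ℝ E ℝ + LinearMap.snd ℝ E ℝ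
  let G : E × ℝ →ₗ[ℝ] ℝ := g ∘ₗ LinearMap.fst ℝ E ℝ - t • LinearMap.snd ℝ E ℝ
  have hτ : ∀ z, τ z = σ z.1 + z.2 := fun z => rfl
  have hG : ∀ z, G z = g z.1 - t * z.2 := fun z => rfl
  have hτc : Continuous τ := τ.continuous_of_finiteDimensional
  have hGc : Continuous G := G.continuous_of_finiteDimensional
  let K : Set (E × ℝ) := {z | z ∈ C ∧ τ z = 1}
  have hKcl : IsClosed K := hC.closed.inter (isClosed_eq hτc continuous_const)
  have hKcpt : IsCompact K := by
    have : ProperSpace (E × ℝ) := FiniteDimensional.proper ℝ _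
    refine Metric.isCompact_of_isClosed_isBounded hKcl
      ((Metric.isBounded_closedBall (x := (0 : E × ℝ)) (r := 1)).subset fun z hz => ?_)
    have h1 := hC.norm_le z hz.1
    have h2 := hC.height_nonneg z hz.1
    have h3 := hz.2
    have h4 := norm_nonneg z.1
    rw [hτ] at h3
    rw [mem_closedBall_zero_iff, Prod.norm_def, max_le_iff, Real.norm_eq_abs, abs_of_nonneg h2]
    exact ⟨by linarith, by linarith⟩
  have hKconv : Convex ℝ K := by
    intro z hz z' hz' α β hα hβ hαβ
    refine ⟨C.add_mem (C.smul_mem hα hz.1) (C.smul_mem hβ hz'.1), ?_⟩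
    rw [map_add, map_smul, map_smul, hz.2, hz'.2, smul_eq_mul, smul_eq_mul, mul_one, mul_one, hαβ]
  have hscale : ∀ z ∈ C, 0 < τ z → (τ z)⁻¹ • z ∈ K := fun z hz h =>
    ⟨C.smul_mem (inv_nonneg.2 h.le) hz, by
      rw [map_smul, smul_eq_mul, inv_mul_cancel₀ h.ne']⟩
  -- an element of a sum decomposition of an extreme point of the base is proportional to it
  have hsplit : ∀ z ∈ K.extremePoints ℝ, ∀ z₁ ∈ C, ∀ z₂ ∈ C, 0 < τ z₁ → 0 < τ z₂ →
      z₁ + z₂ = z → z₁ = τ z₁ • z := by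
    intro z hz z₁ h₁ z₂ h₂ p₁ p₂ hsum
    have := (mem_extremePoints_iff_left.1 hz).2 _ (hscale z₁ h₁ p₁) _ (hscale z₂ h₂ p₂)
      ⟨τ z₁, τ z₂, p₁, p₂, by rw [← map_add, hsum, hz.1.2], by
        rw [smul_inv_smul₀ p₁.ne', smul_inv_smul₀ p₂.ne', hsum]⟩
    rw [← this, smul_inv_smul₀ p₁.ne']
  -- An extreme point of the base at height zero is an extreme ray of the slice; one at height `s >
  -- 0` is, after division by `s`, an extreme point of the slice.
  have hext : ∀ z ∈ K.extremePoints ℝ, G z ≤ 0 := by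
    rintro ⟨y, s⟩ hz
    have hyC : (y, s) ∈ C := hz.1.1
    have hσs : σ y + s = 1 := hz.1.2
    have hs : 0 ≤ s := hC.height_nonneg _ hyC
    rw [hG]
    rcases hs.eq_or_lt with rfl | hs
    · suffices y ∈ extremeRays (heightOne C) by simpa using hr y this
      refine ⟨(hC.mem_recessionCone hne).2 hyC, ?_, ?_⟩
      · rintro rfl
        simp at hσs
      · intro r₁ h₁ r₂ h₂ hsum
        rw [hC.mem_recessionCone hne] at h₁ h₂
        have main : ∀ r r' : E, (r, (0 : ℝ)) ∈ C → (r', (0 : ℝ)) ∈ C → r + r' = y →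
            ∃ t : ℝ, 0 ≤ t ∧ r = t • y := by
          intro r r' h h' hrr
          have e : τ (r, 0) = σ r := add_zero _
          have e' : τ (r', 0) = σ r' := add_zero _
          rcases (hC.nonneg h).eq_or_lt with h0 | hpos
          · exact ⟨0, le_rfl, by rw [zero_smul]; exact hC.eq_zero h h0.symm.le⟩
          rcases (hC.nonneg h').eq_or_lt with h0 | hpos'
          · have : r' = 0 := hC.eq_zero h' h0.symm.le
            exact ⟨1, zero_le_one, by rw [one_smul, ← hrr, this, add_zero]⟩
          refine ⟨σ r, hpos.le, ?_⟩
          have := hsplit _ hz _ h _ h' (by rw [e]; exact hpos) (by rw [e']; exact hpos')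
            (by rw [Prod.mk_add_mk, hrr, add_zero])
          rw [e] at this
          exact congrArg Prod.fst this
        exact ⟨main r₁ r₂ h₁ h₂ hsum, main r₂ r₁ h₂ h₁ (by rw [add_comm, hsum])⟩
    · suffices s⁻¹ • y ∈ (heightOne C).extremePoints ℝ by
        have := hp _ this
        rw [map_smul, smul_eq_mul, inv_mul_le_iff₀ hs] at this
        simp only
        linarith
      refine mem_extremePoints_iff_left.2 ⟨inv_smul_mem_heightOne hyC hs, ?_⟩
      rintro p₁ h₁ p₂ h₂ ⟨α, β, hα, hβ, hαβ, hsum⟩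
      -- A convex combination for `s⁻¹ • y` splits `(y, s)` into parts of heights `s * α` and `s *
      -- β`. The first is proportional to `(y, s)`, and comparing heights shows that the factor is
      -- `α`.
      have m₁ := smul_mem_of_mem_heightOne h₁ (mul_pos hs hα).le
      have m₂ := smul_mem_of_mem_heightOne h₂ (mul_pos hs hβ).le
      have t₁ : 0 < τ ((s * α) • p₁, s * α) :=
        add_pos_of_nonneg_of_pos (hC.nonneg m₁) (mul_pos hs hα)
      have t₂ : 0 < τ ((s * β) • p₂, s * β) :=
        add_pos_of_nonneg_of_pos (hC.nonneg m₂) (mul_pos hs hβ)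
      have := hsplit _ hz _ m₁ _ m₂ t₁ t₂ (by
        rw [Prod.mk_add_mk, mul_smul, mul_smul, ← smul_add, hsum, smul_inv_smul₀ hs.ne',
          ← mul_add, hαβ, mul_one])
      obtain ⟨k, hk⟩ : ∃ k, k = τ ((s * α) • p₁, s * α) := ⟨_, rfl⟩
      rw [← hk, Prod.smul_mk, Prod.mk.injEq] at this
      obtain ⟨q₁, q₂⟩ := this
      have hkα : k = α := by
        rw [smul_eq_mul, mul_comm] at q₂
        exact (mul_right_cancel₀ hs.ne' q₂).symm
      rw [hkα, mul_comm, mul_smul] at q₁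
      rw [← smul_right_injective E hα.ne' q₁, inv_smul_smul₀ hs.ne']
  -- Krein–Milman for the compact base.
  have hhull : K ⊆ {z | G z ≤ 0} := by
    rw [← closure_convexHull_extremePoints hKcpt hKconv]
    exact closure_minimal (convexHull_min hext (convex_halfSpace_le G.isLinear 0))
      (isClosed_le hGc continuous_const)
  have hpos : 0 < τ (x, 1) := add_pos_of_nonneg_of_pos (hC.nonneg hx) one_pos
  have := hhull (hscale _ hx hpos)
  rw [Set.mem_ofPred_eq, map_smul, smul_eq_mul, hG, inv_mul_le_iff₀ hpos] at this
  simp only at this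
  linarith

/-- Since `-σ ≤ 0` on recession directions, without extreme points `le_of_extreme` would bound `-σ`
by any number, in particular by one less than its value at `x`. -/
theorem extremePoints_nonempty [FiniteDimensional ℝ E] (hC : IsHomogenization C σ)
    (hne : (heightOne C).Nonempty) : ((heightOne C).extremePoints ℝ).Nonempty := by
  by_contra hcon
  rw [Set.not_nonempty_iff_eq_empty] at hcon
  obtain ⟨x, hx⟩ := hne
  have := hC.le_of_extreme (-σ) (-σ x - 1) (by simp [hcon]) (fun r hr => by
    have := hC.nonneg ((hC.mem_recessionCone ⟨x, hx⟩).1 hr.1)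
    simpa using this) hx
  rw [LinearMap.neg_apply] at this
  linarith

/-- A positive value on a recession direction would make `g` unbounded above; the converse is
`le_of_extreme`. -/
theorem forall_le_iff [FiniteDimensional ℝ E] (hC : IsHomogenization C σ)
    (hne : (heightOne C).Nonempty) (g : E →ₗ[ℝ] ℝ) (t : ℝ) :
    (∀ x ∈ heightOne C, g x ≤ t) ↔ (∀ x ∈ (heightOne C).extremePoints ℝ, g x ≤ t) ∧
      ∀ r ∈ extremeRays (heightOne C), g r ≤ 0 := by
  refine ⟨fun h => ⟨fun x hx => h x hx.1, fun r hr => ?_⟩,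
    fun h x hx => hC.le_of_extreme g t h.1 h.2 hx⟩
  obtain ⟨x, hx⟩ := hne
  by_contra hcon
  push Not at hcon
  have h1 := h _ (hr.1 x hx ((|t - g x| + 1) / g r) (by positivity))
  rw [map_add, map_smul, smul_eq_mul, div_mul_cancel₀ _ hcon.ne'] at h1
  have := le_abs_self (t - g x)
  linarith

end IsHomogenization
end Normed

/-! ### Extreme points and rays of the coupled set -/

section Coupling

variable {E₁ E₂ : Type*} [NormedAddCommGroup E₁] [NormedSpace ℝ E₁] [NormedAddCommGroup E₂]
  [NormedSpace ℝ E₂]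

/-- The homogenization of the set of pairs `(a, q)` for which `a` is in the set homogenized by `C₂`
and `q` is in `w a` times the set homogenized by `C₁`. -/
def coupledCone (C₁ : PointedCone ℝ (E₁ × ℝ)) (C₂ : PointedCone ℝ (E₂ × ℝ)) (w : E₂ →ₗ[ℝ] ℝ) :
    PointedCone ℝ ((E₂ × E₁) × ℝ) where
  carrier := {z | (z.1.1, z.2) ∈ C₂ ∧ (z.1.2, w z.1.1) ∈ C₁}
  add_mem' := fun {z z'} h h' => ⟨C₂.add_mem h.1 h'.1, by
    have := C₁.add_mem h.2 h'.2
    rwa [Prod.mk_add_mk, ← map_add] at this⟩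
  zero_mem' := ⟨C₂.zero_mem, by
    change ((0 : E₁), w 0) ∈ C₁
    rw [map_zero]
    exact C₁.zero_mem⟩
  smul_mem' := fun c z h => ⟨Submodule.smul_mem C₂ c h.1, by
    have := Submodule.smul_mem C₁ c h.2
    have e : w (c • z.1.1) = c • w z.1.1 := map_smul w (c : ℝ) z.1.1
    rw [Prod.smul_mk, ← e] at this
    exact this⟩

variable {C₁ : PointedCone ℝ (E₁ × ℝ)} {C₂ : PointedCone ℝ (E₂ × ℝ)} {w : E₂ →ₗ[ℝ] ℝ}
  {σ₁ : E₁ →ₗ[ℝ] ℝ} {σ₂ : E₂ →ₗ[ℝ] ℝ}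

theorem mem_heightOne_coupledCone {a : E₂} {q : E₁} :
    (a, q) ∈ heightOne (coupledCone C₁ C₂ w) ↔ a ∈ heightOne C₂ ∧ (q, w a) ∈ C₁ := Iff.rfl

theorem IsHomogenization.coupledCone [FiniteDimensional ℝ E₂] (h₁ : IsHomogenization C₁ σ₁)
    (h₂ : IsHomogenization C₂ σ₂) :
    IsHomogenization (coupledCone C₁ C₂ w)
      (σ₂ ∘ₗ LinearMap.fst ℝ E₂ E₁ + σ₁ ∘ₗ LinearMap.snd ℝ E₂ E₁) where
  closed := by
    have hw : Continuous w := w.continuous_of_finiteDimensional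
    exact (h₂.closed.preimage (f := fun z : (E₂ × E₁) × ℝ => (z.1.1, z.2)) (by fun_prop)).inter
      (h₁.closed.preimage (f := fun z : (E₂ × E₁) × ℝ => (z.1.2, w z.1.1)) (by fun_prop))
  height_nonneg := fun z hz => h₂.height_nonneg _ hz.1
  norm_le := by
    rintro ⟨⟨a, q⟩, s⟩ ⟨ha, hq⟩
    have n₁ := h₁.norm_le _ hq
    have n₂ := h₂.norm_le _ ha
    have p₁ := h₁.nonneg hq
    have p₂ := h₂.nonneg ha
    simp only [LinearMap.add_apply, LinearMap.comp_apply, LinearMap.fst_apply,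
      LinearMap.snd_apply, Prod.norm_def, max_le_iff] at *
    exact ⟨by linarith, by linarith⟩

theorem heightOne_coupledCone_nonempty (hw : ∀ z ∈ C₂, 0 ≤ w z.1)
    (ne₁ : (heightOne C₁).Nonempty) (ne₂ : (heightOne C₂).Nonempty) :
    (heightOne (coupledCone C₁ C₂ w)).Nonempty := by
  obtain ⟨q, hq⟩ := ne₁
  obtain ⟨a, ha⟩ := ne₂
  exact ⟨(a, w a • q), mem_heightOne_coupledCone.2
    ⟨ha, smul_mem_of_mem_heightOne hq (hw _ ha)⟩⟩

theorem extremePoints_coupledCone [FiniteDimensional ℝ E₁]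
    (h₁ : IsHomogenization C₁ σ₁) (hw : ∀ z ∈ C₂, 0 ≤ w z.1) (ne₁ : (heightOne C₁).Nonempty) :
    (heightOne (coupledCone C₁ C₂ w)).extremePoints ℝ =
      {z | ∃ a ∈ (heightOne C₂).extremePoints ℝ, ∃ q ∈ (heightOne C₁).extremePoints ℝ,
        z = (a, w a • q)} := by
  ext ⟨a, q⟩
  constructor
  · intro h
    obtain ⟨⟨ha, hq⟩, hext⟩ := mem_extremePoints_iff_left.1 h
    -- Any convex decomposition of `a` lifts to one of `(a, w a • q')`, with the same `q'` in both
    -- parts, because `w` is linear.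
    have main : ∀ q' ∈ heightOne C₁, q = w a • q' → a ∈ (heightOne C₂).extremePoints ℝ := by
      intro q' hq' hqq
      refine mem_extremePoints_iff_left.2 ⟨ha, ?_⟩
      rintro a₁ m₁ a₂ m₂ ⟨α, β, hα, hβ, hαβ, hsum⟩
      have := hext (a₁, w a₁ • q') ⟨m₁, smul_mem_of_mem_heightOne hq' (hw _ m₁)⟩
        (a₂, w a₂ • q') ⟨m₂, smul_mem_of_mem_heightOne hq' (hw _ m₂)⟩
        ⟨α, β, hα, hβ, hαβ, by
          rw [Prod.smul_mk, Prod.smul_mk, Prod.mk_add_mk, hsum, smul_smul, smul_smul, ← add_smul,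
            hqq, ← hsum, map_add, map_smul, map_smul, smul_eq_mul, smul_eq_mul]⟩
      exact congrArg Prod.fst this
    rcases (hw _ ha).eq_or_lt with h0 | hpos
    · simp only at h0
      change (q, w a) ∈ C₁ at hq
      rw [← h0] at hq
      -- At `w a = 0` the vector `q` is a recession direction, and `(a, q)` is the midpoint of `(a,
      -- 0)` and `(a, 2 • q)`.
      have hq0 : q = 0 := by
        have := hext (a, 0) ⟨ha, by rw [← h0]; exact C₁.zero_mem⟩ (a, (2 : ℝ) • q)
          ⟨ha, by rw [← h0]; exact smul_recession_mem hq zero_le_two⟩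
          ⟨1 / 2, 1 / 2, by norm_num, by norm_num, by norm_num, by
            rw [Prod.smul_mk, Prod.smul_mk, Prod.mk_add_mk, ← add_smul, smul_zero, zero_add,
              smul_smul]
            norm_num⟩
        exact (congrArg Prod.snd this).symm
      -- The factor `w a = 0` annihilates `q'`, so any extreme point serves.
      obtain ⟨q', hq'⟩ := h₁.extremePoints_nonempty ne₁
      have e : q = w a • q' := by rw [← h0, zero_smul, hq0]
      exact ⟨a, main q' hq'.1 e, q', hq', by rw [← e]⟩
    · have e : q = w a • ((w a)⁻¹ • q) := (smul_inv_smul₀ hpos.ne' q).symm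
      have hq' : (w a)⁻¹ • q ∈ heightOne C₁ := inv_smul_mem_heightOne hq hpos
      refine ⟨a, main _ hq' e, (w a)⁻¹ • q, mem_extremePoints_iff_left.2 ⟨hq', ?_⟩, by rw [← e]⟩
      rintro q₁ m₁ q₂ m₂ ⟨α, β, hα, hβ, hαβ, hsum⟩
      have := hext (a, w a • q₁) ⟨ha, smul_mem_of_mem_heightOne m₁ hpos.le⟩
        (a, w a • q₂) ⟨ha, smul_mem_of_mem_heightOne m₂ hpos.le⟩
        ⟨α, β, hα, hβ, hαβ, by
          rw [Prod.smul_mk, Prod.smul_mk, Prod.mk_add_mk, ← add_smul, hαβ, one_smul, smul_comm α,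
            smul_comm β, ← smul_add, hsum, ← e]⟩
      have hq₁ : w a • q₁ = q := congrArg Prod.snd this
      rw [← hq₁]
      exact (inv_smul_smul₀ hpos.ne' q₁).symm
  · rintro ⟨a', ha', q', hq', e⟩
    obtain ⟨rfl, rfl⟩ := Prod.mk.inj e
    refine mem_extremePoints_iff_left.2
      ⟨⟨ha'.1, smul_mem_of_mem_heightOne hq'.1 (hw _ ha'.1)⟩, ?_⟩
    rintro ⟨a₁, q₁⟩ ⟨m₁, n₁⟩ ⟨a₂, q₂⟩ ⟨m₂, n₂⟩ ⟨α, β, hα, hβ, hαβ, hsum⟩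
    rw [Prod.smul_mk, Prod.smul_mk, Prod.mk_add_mk, Prod.mk.injEq] at hsum
    obtain ⟨hsa, hsq⟩ := hsum
    have ea := (mem_extremePoints.1 ha').2 a₁ m₁ a₂ m₂ ⟨α, β, hα, hβ, hαβ, hsa⟩
    change (q₁, w a₁) ∈ C₁ at n₁
    change (q₂, w a₂) ∈ C₁ at n₂
    rw [ea.1] at n₁
    rw [ea.2] at n₂
    rw [ea.1]
    congr 1
    -- At `w = 0` the two parts of the second block are recession directions with weighted sum zero,
    -- so they vanish by pointedness.
    rcases (hw _ ha'.1).eq_or_lt with h0 | hpos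
    · simp only at h0
      rw [← h0] at n₁ n₂ hsq ⊢
      have := (h₁.eq_zero_of_add (smul_recession_mem n₁ hα.le) (smul_recession_mem n₂ hβ.le)
        (by rw [hsq, zero_smul])).1
      rw [zero_smul]
      exact (smul_eq_zero.1 this).resolve_left hα.ne'
    · have := (mem_extremePoints_iff_left.1 hq').2 _ (inv_smul_mem_heightOne n₁ hpos) _
        (inv_smul_mem_heightOne n₂ hpos) ⟨α, β, hα, hβ, hαβ, by
          rw [smul_comm α, smul_comm β, ← smul_add, hsq, inv_smul_smul₀ hpos.ne']⟩
      rw [← this, smul_inv_smul₀ hpos.ne']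

theorem extremeRays_coupledCone [FiniteDimensional ℝ E₂]
    (h₁ : IsHomogenization C₁ σ₁) (h₂ : IsHomogenization C₂ σ₂) (hw : ∀ z ∈ C₂, 0 ≤ w z.1)
    (ne₁ : (heightOne C₁).Nonempty) (ne₂ : (heightOne C₂).Nonempty) :
    extremeRays (heightOne (coupledCone C₁ C₂ w)) =
      {z | ∃ q ∈ extremeRays (heightOne C₁), z = (0, q)} ∪
      {z | ∃ a ∈ extremeRays (heightOne C₂), w a = 0 ∧ z = (a, 0)} ∪
      {z | ∃ q ∈ (heightOne C₁).extremePoints ℝ, ∃ a ∈ extremeRays (heightOne C₂), 0 < w a ∧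
        z = (a, w a • q)} := by
  have hrec : ∀ z : E₂ × E₁, z ∈ recessionCone (heightOne (coupledCone C₁ C₂ w)) ↔
      (z.1, (0 : ℝ)) ∈ C₂ ∧ (z.2, w z.1) ∈ C₁ := fun z =>
    (h₁.coupledCone h₂).mem_recessionCone (heightOne_coupledCone_nonempty hw ne₁ ne₂)
  have hrec₁ : ∀ q : E₁, q ∈ recessionCone (heightOne C₁) ↔ (q, (0 : ℝ)) ∈ C₁ := fun q =>
    h₁.mem_recessionCone ne₁
  have hrec₂ : ∀ a : E₂, a ∈ recessionCone (heightOne C₂) ↔ (a, (0 : ℝ)) ∈ C₂ := fun a =>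
    h₂.mem_recessionCone ne₂
  ext ⟨a, q⟩
  simp only [extremeRays, Set.mem_union, Set.mem_ofPred_eq, hrec, hrec₁, hrec₂]
  constructor
  · rintro ⟨⟨ha, hq⟩, hne, hext⟩
    rcases (hw _ ha).eq_or_lt with h0 | hpos
    · left
      simp only at h0
      rw [← h0] at hq
      -- Splitting `(a, q) = (a, 0) + (0, q)` forces `(a, 0)` to be a multiple `t • (a, q)`. Then `t
      -- • q = 0`, so either `t = 0` and `a = 0`, or `q = 0`.
      have hd := (hext (a, 0) ⟨ha, by rw [← h0]; exact C₁.zero_mem⟩ (0, q)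
        ⟨C₂.zero_mem, by rw [map_zero]; exact hq⟩ (by rw [Prod.mk_add_mk, add_zero, zero_add])).1
      obtain ⟨t, -, ht⟩ := hd
      rw [Prod.smul_mk, Prod.mk.injEq] at ht
      rcases smul_eq_zero.1 ht.2.symm with rfl | rfl
      · have ha0 : a = 0 := by rw [ht.1, zero_smul]
        subst ha0
        refine Or.inl ⟨q, ⟨hq, fun h => hne (by rw [h]; rfl), fun r₁ m₁ r₂ m₂ hr => ?_⟩, rfl⟩
        obtain ⟨⟨t₁, p₁, e₁⟩, ⟨t₂, p₂, e₂⟩⟩ := hext (0, r₁)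
          ⟨C₂.zero_mem, by rw [map_zero]; exact m₁⟩ (0, r₂)
          ⟨C₂.zero_mem, by rw [map_zero]; exact m₂⟩ (by rw [Prod.mk_add_mk, add_zero, hr])
        exact ⟨⟨t₁, p₁, congrArg Prod.snd e₁⟩, ⟨t₂, p₂, congrArg Prod.snd e₂⟩⟩
      · refine Or.inr ⟨a, ⟨ha, fun h => hne (by rw [h]; rfl), fun r₁ m₁ r₂ m₂ hr => ?_⟩, h0.symm,
          rfl⟩
        have hwr : w r₁ + w r₂ = 0 := by rw [← map_add, hr, ← h0]
        have w₁ : 0 ≤ w r₁ := hw _ m₁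
        have w₂ : 0 ≤ w r₂ := hw _ m₂
        have w₁' : w r₁ = 0 := by linarith
        have w₂' : w r₂ = 0 := by linarith
        obtain ⟨⟨t₁, p₁, e₁⟩, ⟨t₂, p₂, e₂⟩⟩ := hext (r₁, 0)
          ⟨m₁, by rw [w₁']; exact C₁.zero_mem⟩ (r₂, 0)
          ⟨m₂, by rw [w₂']; exact C₁.zero_mem⟩ (by rw [Prod.mk_add_mk, add_zero, hr])
        exact ⟨⟨t₁, p₁, congrArg Prod.fst e₁⟩, ⟨t₂, p₂, congrArg Prod.fst e₂⟩⟩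
    · right
      have hpos' : 0 < w a := hpos
      have e : w a • ((w a)⁻¹ • q) = q := smul_inv_smul₀ hpos.ne' q
      have hq' : (w a)⁻¹ • q ∈ heightOne C₁ := inv_smul_mem_heightOne hq hpos
      refine ⟨(w a)⁻¹ • q, mem_extremePoints_iff_left.2 ⟨hq', ?_⟩, a,
        ⟨ha, fun h => hpos'.ne' (by rw [h, map_zero]), fun r₁ m₁ r₂ m₂ hr => ?_⟩, hpos, by rw [e]⟩
      · rintro q₁ m₁ q₂ m₂ ⟨α, β, hα, hβ, hαβ, hsum⟩
        have wα : w (α • a) = α * w a := by rw [map_smul, smul_eq_mul]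
        have wβ : w (β • a) = β * w a := by rw [map_smul, smul_eq_mul]
        -- The weights of a convex combination are moved onto the ray: `a` is split as `α • a + β •
        -- a`, and `q₁`, `q₂` are attached to the parts.
        obtain ⟨⟨t, -, ht⟩, -⟩ := hext (α • a, w (α • a) • q₁)
          ⟨smul_recession_mem ha hα.le,
            smul_mem_of_mem_heightOne m₁ (by rw [wα]; exact (mul_pos hα hpos).le)⟩
          (β • a, w (β • a) • q₂)
          ⟨smul_recession_mem ha hβ.le,
            smul_mem_of_mem_heightOne m₂ (by rw [wβ]; exact (mul_pos hβ hpos).le)⟩ (by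
            rw [Prod.mk_add_mk, ← add_smul, hαβ, one_smul, wα, wβ, mul_comm α, mul_comm β,
              mul_smul, mul_smul, ← smul_add, hsum, e])
        rw [Prod.smul_mk, Prod.mk.injEq] at ht
        have htα : α = t := by
          have := congrArg w ht.1
          rw [map_smul, map_smul, smul_eq_mul, smul_eq_mul] at this
          exact mul_right_cancel₀ hpos'.ne' this
        have h3 := ht.2
        rw [wα, ← htα, mul_smul] at h3
        rw [← smul_right_injective E₁ hα.ne' h3, inv_smul_smul₀ hpos'.ne']
      · obtain ⟨⟨t₁, p₁, e₁⟩, ⟨t₂, p₂, e₂⟩⟩ := hext (r₁, w r₁ • ((w a)⁻¹ • q))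
          ⟨m₁, smul_mem_of_mem_heightOne hq' (hw _ m₁)⟩ (r₂, w r₂ • ((w a)⁻¹ • q))
          ⟨m₂, smul_mem_of_mem_heightOne hq' (hw _ m₂)⟩
          (by rw [Prod.mk_add_mk, ← add_smul, ← map_add, hr, e])
        exact ⟨⟨t₁, p₁, congrArg Prod.fst e₁⟩, ⟨t₂, p₂, congrArg Prod.fst e₂⟩⟩
  · rintro ((⟨q', ⟨hq, hne, hext⟩, e⟩ | ⟨a', ⟨ha, hne, hext⟩, hwa, e⟩) |
      ⟨q', hq, a', ⟨ha, hne, hext⟩, hpos, e⟩)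
    · obtain ⟨rfl, rfl⟩ := Prod.mk.inj e
      refine ⟨⟨C₂.zero_mem, by rw [map_zero]; exact hq⟩, fun h => hne (congrArg Prod.snd h), ?_⟩
      rintro ⟨a₁, q₁⟩ ⟨m₁, n₁⟩ ⟨a₂, q₂⟩ ⟨m₂, n₂⟩ hr
      rw [Prod.mk_add_mk, Prod.mk.injEq] at hr
      obtain ⟨z₁, z₂⟩ := h₂.eq_zero_of_add m₁ m₂ hr.1
      simp only at z₁ z₂
      subst z₁ z₂
      rw [map_zero] at n₁ n₂
      obtain ⟨⟨t₁, p₁, e₁⟩, ⟨t₂, p₂, e₂⟩⟩ := hext q₁ n₁ q₂ n₂ hr.2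
      exact ⟨⟨t₁, p₁, by rw [Prod.smul_mk, smul_zero, ← e₁]⟩,
        ⟨t₂, p₂, by rw [Prod.smul_mk, smul_zero, ← e₂]⟩⟩
    · obtain ⟨rfl, rfl⟩ := Prod.mk.inj e
      refine ⟨⟨ha, by rw [hwa]; exact C₁.zero_mem⟩, fun h => hne (congrArg Prod.fst h), ?_⟩
      rintro ⟨a₁, q₁⟩ ⟨m₁, n₁⟩ ⟨a₂, q₂⟩ ⟨m₂, n₂⟩ hr
      rw [Prod.mk_add_mk, Prod.mk.injEq] at hr
      obtain ⟨z₁, z₂⟩ := h₁.eq_zero_of_add n₁ n₂ hr.2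
      simp only at z₁ z₂
      subst z₁ z₂
      obtain ⟨⟨t₁, p₁, e₁⟩, ⟨t₂, p₂, e₂⟩⟩ := hext a₁ m₁ a₂ m₂ hr.1
      exact ⟨⟨t₁, p₁, by rw [Prod.smul_mk, smul_zero, ← e₁]⟩,
        ⟨t₂, p₂, by rw [Prod.smul_mk, smul_zero, ← e₂]⟩⟩
    · obtain ⟨rfl, rfl⟩ := Prod.mk.inj e
      refine ⟨⟨ha, smul_mem_of_mem_heightOne hq.1 hpos.le⟩, fun h => hne (congrArg Prod.fst h), ?_⟩
      have main : ∀ z₁ z₂ : E₂ × E₁, (z₁.2, w z₁.1) ∈ C₁ → (z₂.2, w z₂.1) ∈ C₁ →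
          z₁ + z₂ = (a, w a • q') → ∀ t₁ t₂ : ℝ, 0 ≤ t₁ → z₁.1 = t₁ • a → 0 ≤ t₂ →
          z₂.1 = t₂ • a → z₁ = t₁ • (a, w a • q') := by
        rintro ⟨a₁, q₁⟩ ⟨a₂, q₂⟩ n₁ n₂ hr t₁ t₂ p₁ e₁ p₂ e₂
        simp only at n₁ n₂ e₁ e₂
        rw [Prod.mk_add_mk, Prod.mk.injEq] at hr
        obtain ⟨hra, hrq⟩ := hr
        have ht : t₁ + t₂ = 1 := by
          have := congrArg w hra
          rw [e₁, e₂, ← add_smul, map_smul, smul_eq_mul] at this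
          exact mul_right_cancel₀ hpos.ne' (this.trans (one_mul _).symm)
        rw [e₁, map_smul, smul_eq_mul] at n₁
        rw [e₂, map_smul, smul_eq_mul] at n₂
        have hqs : (w a)⁻¹ • q₁ + (w a)⁻¹ • q₂ = q' := by
          rw [← smul_add, hrq, inv_smul_smul₀ hpos.ne']
        rw [e₁, Prod.smul_mk, Prod.mk.injEq]
        refine ⟨rfl, ?_⟩
        have hext' := (mem_extremePoints_iff_left.1 hq).2
        -- a recession direction that is split off from an extreme point vanishes
        have vanish : ∀ r s : E₁, (r, (0 : ℝ)) ∈ C₁ → s ∈ heightOne C₁ → s + r = q' → s = q' := by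
          intro r s hr hs hrs
          refine hext' s hs (s + (2 : ℝ) • r)
            (add_mem_heightOne hs (smul_recession_mem hr zero_le_two))
            ⟨1 / 2, 1 / 2, by norm_num, by norm_num, by norm_num, ?_⟩
          rw [← hrs, smul_add, ← add_assoc, ← add_smul, smul_smul]
          norm_num
        -- If one `tᵢ` is zero, its part of `q'` is a recession direction and vanishes. Otherwise
        -- rescaling both parts to height one writes `q'` as a convex combination with weights `t₁`,
        -- `t₂`.
        rcases p₁.eq_or_lt with rfl | p₁
        · have t1 : t₂ = 1 := by linarith
          rw [t1, one_mul] at n₂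
          rw [zero_mul] at n₁
          have h4 := vanish _ _ (smul_recession_mem n₁ (inv_nonneg.2 hpos.le))
            (inv_smul_mem_heightOne n₂ hpos) (by rw [add_comm]; exact hqs)
          rw [h4, add_eq_right, smul_eq_zero] at hqs
          rw [zero_smul]
          exact hqs.resolve_left (inv_ne_zero hpos.ne')
        rcases p₂.eq_or_lt with rfl | p₂
        · have t1 : t₁ = 1 := by linarith
          rw [t1, one_mul] at n₁
          rw [zero_mul] at n₂
          have h4 := vanish _ _ (smul_recession_mem n₂ (inv_nonneg.2 hpos.le))
            (inv_smul_mem_heightOne n₁ hpos) hqs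
          rw [t1, one_smul, ← h4, smul_inv_smul₀ hpos.ne']
        · have h5 := hext' _ (inv_smul_mem_heightOne n₁ (mul_pos p₁ hpos)) _
            (inv_smul_mem_heightOne n₂ (mul_pos p₂ hpos)) ⟨t₁, t₂, p₁, p₂, ht, by
              rw [mul_inv, mul_inv, mul_smul, mul_smul, smul_inv_smul₀ p₁.ne',
                smul_inv_smul₀ p₂.ne', hqs]⟩
          rw [← h5, smul_smul, smul_inv_smul₀ (mul_pos p₁ hpos).ne']
      rintro z₁ m₁ z₂ m₂ hr
      obtain ⟨⟨t₁, p₁, e₁⟩, ⟨t₂, p₂, e₂⟩⟩ := hext z₁.1 m₁.1 z₂.1 m₂.1 (congrArg Prod.fst hr)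
      exact ⟨⟨t₁, p₁, main z₁ z₂ m₁.2 m₂.2 hr t₁ t₂ p₁ e₁ p₂ e₂⟩,
        ⟨t₂, p₂, main z₂ z₁ m₂.2 m₁.2 (by rw [add_comm]; exact hr) t₂ t₁ p₂ e₂ p₁ e₁⟩⟩

end Coupling

/-! ### Invariance under linear equivalences -/

section Transport

variable {E F : Type*} [AddCommGroup E] [Module ℝ E] [AddCommGroup F] [Module ℝ F]

theorem recessionCone_preimage (e : E ≃ₗ[ℝ] F) (S : Set F) :
    recessionCone (e ⁻¹' S) = e ⁻¹' recessionCone S := by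
  ext r
  refine ⟨fun h z hz t ht => ?_, fun h z hz t ht => ?_⟩
  · have := h (e.symm z) (by simpa using hz) t ht
    simpa using this
  · have := h (e z) hz t ht
    simpa using this

theorem extremeRays_preimage (e : E ≃ₗ[ℝ] F) (S : Set F) :
    extremeRays (e ⁻¹' S) = e ⁻¹' extremeRays S := by
  ext r
  simp only [extremeRays, recessionCone_preimage, Set.mem_preimage, Set.mem_ofPred_eq, ne_eq,
    LinearEquiv.map_eq_zero_iff]
  refine and_congr_right fun _ => and_congr_right fun _ => ⟨fun h r₁ m₁ r₂ m₂ hr => ?_,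
    fun h r₁ m₁ r₂ m₂ hr => ?_⟩
  · have := h (e.symm r₁) (by simpa using m₁) (e.symm r₂) (by simpa using m₂)
      (by rw [← map_add, hr, LinearEquiv.symm_apply_apply])
    simpa [LinearEquiv.symm_apply_eq] using this
  · have := h (e r₁) m₁ (e r₂) m₂ (by rw [← map_add, hr])
    simpa only [← map_smul, e.injective.eq_iff] using this

theorem extremePoints_preimage (e : E ≃ₗ[ℝ] F) (S : Set F) :
    (e ⁻¹' S).extremePoints ℝ = e ⁻¹' S.extremePoints ℝ := by
  have h : ∀ T : Set F, e ⁻¹' T = e.symm '' T := fun T => (e.symm.image_eq_preimage_symm T).symm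
  rw [h, h, image_extremePoints]

end Transport

/-! ### Coordinate sums and dot products -/

section CoordSum

/-- The sum of the coordinates of a vector. -/
def coordSum (ι : Type*) [Fintype ι] : (ι → ℝ) →ₗ[ℝ] ℝ := ∑ i, LinearMap.proj i

theorem norm_le_coordSum {ι : Type*} [Fintype ι] {v : ι → ℝ} (hv : 0 ≤ v) :
    ‖v‖ ≤ coordSum ι v := by
  have h : coordSum ι v = ∑ i, v i := by simp [coordSum]
  rw [h, pi_norm_le_iff_of_nonneg (Finset.sum_nonneg fun i _ => hv i)]
  intro i
  rw [Real.norm_eq_abs, abs_of_nonneg (hv i)]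
  exact Finset.single_le_sum (f := v) (fun j _ => hv j) (Finset.mem_univ i)

theorem le_of_forall_dotProduct_le {ι : Type*} [Fintype ι] [DecidableEq ι] {a b : ι → ℝ}
    (h : ∀ u : ι → ℝ, 0 ≤ u → u ⬝ᵥ a ≤ u ⬝ᵥ b) : a ≤ b := fun i => by
  simpa using h (Pi.single i 1) (Pi.single_nonneg.2 zero_le_one)

theorem dotProduct_transpose_mulVec_comm {ι κ : Type*} [Fintype ι] [Fintype κ] (M : Matrix ι κ ℝ)
    (y : κ → ℝ) (u : ι → ℝ) : y ⬝ᵥ Mᵀ *ᵥ u = u ⬝ᵥ M *ᵥ y := by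
  rw [mulVec_transpose, dotProduct_comm, dotProduct_mulVec]

end CoordSum

/-! ### The polyhedra of the bilevel problem and their nonemptiness -/

namespace Bilevel

variable {n₁ n₂ m p : ℕ} (D : Bilevel n₁ n₂ m p)

/-- The homogenization of `set₁`. -/
def cone₁ : PointedCone ℝ (((Fin n₂ → ℝ) × (D.McRow → ℝ)) × ℝ) where
  carrier := {z | z.2 • D.b ≤ D.B *ᵥ z.1.1 - D.Kpsiᵀ *ᵥ z.1.2 ∧ D.Ksᵀ *ᵥ z.1.2 ≤ z.2 • 1 ∧
    0 ≤ z.1.1 ∧ 0 ≤ z.1.2 ∧ 0 ≤ z.2}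
  add_mem' := by
    rintro z z' ⟨h1, h2, h3, h4, h5⟩ ⟨h1', h2', h3', h4', h5'⟩
    refine ⟨?_, ?_, add_nonneg h3 h3', add_nonneg h4 h4', add_nonneg h5 h5'⟩
    · have := add_le_add h1 h1'
      rwa [← add_smul, sub_add_sub_comm, ← mulVec_add, ← mulVec_add] at this
    · have := add_le_add h2 h2'
      rwa [← add_smul, ← mulVec_add] at this
  zero_mem' := by simp
  smul_mem' := by
    rintro ⟨c, hc⟩ z ⟨h1, h2, h3, h4, h5⟩
    refine ⟨?_, ?_, smul_nonneg hc h3, smul_nonneg hc h4, smul_nonneg hc h5⟩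
    · have := smul_le_smul_of_nonneg_left h1 hc
      rwa [smul_sub, ← mulVec_smul, ← mulVec_smul, smul_smul] at this
    · have := smul_le_smul_of_nonneg_left h2 hc
      rwa [← mulVec_smul, smul_smul] at this

/-- The homogenization of `set₂`. -/
def cone₂ : PointedCone ℝ (((Fin m → ℝ) × (Fin p → ℝ) × ℝ) × ℝ) where
  carrier := {z | D.Bᵀ *ᵥ z.1.1 + D.Gyᵀ *ᵥ z.1.2.1 ≤ z.1.2.2 • D.d + z.2 • D.cy ∧
    0 ≤ z.1.1 ∧ 0 ≤ z.1.2.1 ∧ 0 ≤ z.1.2.2 ∧ 0 ≤ z.2}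
  add_mem' := by
    rintro z z' ⟨h1, h2, h3, h4, h5⟩ ⟨h1', h2', h3', h4', h5'⟩
    refine ⟨?_, add_nonneg h2 h2', add_nonneg h3 h3', add_nonneg h4 h4', add_nonneg h5 h5'⟩
    have := add_le_add h1 h1'
    rwa [add_add_add_comm, add_add_add_comm (z.1.2.2 • D.d), ← add_smul, ← add_smul, ← mulVec_add,
      ← mulVec_add] at this
  zero_mem' := by simp
  smul_mem' := by
    rintro ⟨c, hc⟩ z ⟨h1, h2, h3, h4, h5⟩
    refine ⟨?_, smul_nonneg hc h2, smul_nonneg hc h3, smul_nonneg hc h4, smul_nonneg hc h5⟩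
    have := smul_le_smul_of_nonneg_left h1 hc
    rwa [smul_add, smul_add, ← mulVec_smul, ← mulVec_smul, smul_smul, smul_smul] at this

/-- The variable `w` of the upper-level related problem. -/
def wCoord (m p : ℕ) : ((Fin m → ℝ) × (Fin p → ℝ) × ℝ) →ₗ[ℝ] ℝ :=
  LinearMap.snd ℝ _ _ ∘ₗ LinearMap.snd ℝ _ _

theorem wCoord_apply (ψ : Fin m → ℝ) (u : Fin p → ℝ) (w : ℝ) : wCoord m p (ψ, u, w) = w := rfl

theorem heightOne_cone₁ : heightOne D.cone₁ = D.set₁ := by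
  ext ⟨y, v⟩
  change (_ ∧ _ ∧ _ ∧ _ ∧ _) ↔ (_ ∧ _ ∧ _ ∧ _)
  simp

theorem heightOne_cone₂ : heightOne D.cone₂ = D.set₂ := by
  ext ⟨ψ, u, w⟩
  change (_ ∧ _ ∧ _ ∧ _ ∧ _) ↔ (_ ∧ _ ∧ _ ∧ _)
  simp

theorem wCoord_nonneg : ∀ z ∈ D.cone₂, 0 ≤ wCoord m p z.1 := fun _ hz => hz.2.2.2.1

theorem isHomogenization_cone₁ : IsHomogenization D.cone₁
    ((coordSum (Fin n₂)).coprod (coordSum D.McRow)) where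
  closed := by
    have h1 : IsClosed {z : ((Fin n₂ → ℝ) × (D.McRow → ℝ)) × ℝ | 
        z.2 • D.b ≤ D.B *ᵥ z.1.1 - D.Kpsiᵀ *ᵥ z.1.2} :=
      isClosed_le (by fun_prop) (by fun_prop)
    have h2 : IsClosed {z : ((Fin n₂ → ℝ) × (D.McRow → ℝ)) × ℝ | D.Ksᵀ *ᵥ z.1.2 ≤ z.2 • 1} :=
      isClosed_le (by fun_prop) (by fun_prop)
    have h3 : IsClosed {z : ((Fin n₂ → ℝ) × (D.McRow → ℝ)) × ℝ | 0 ≤ z.1.1} :=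
      isClosed_le (by fun_prop) (by fun_prop)
    have h4 : IsClosed {z : ((Fin n₂ → ℝ) × (D.McRow → ℝ)) × ℝ | 0 ≤ z.1.2} :=
      isClosed_le (by fun_prop) (by fun_prop)
    have h5 : IsClosed {z : ((Fin n₂ → ℝ) × (D.McRow → ℝ)) × ℝ | 0 ≤ z.2} :=
      isClosed_le (by fun_prop) (by fun_prop)
    exact h1.inter (h2.inter (h3.inter (h4.inter h5)))
  height_nonneg := fun _ hz => hz.2.2.2.2
  norm_le := by
    rintro ⟨⟨y, v⟩, s⟩ ⟨-, -, hy, hv, -⟩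
    have h1 := norm_le_coordSum hy
    have h2 := norm_le_coordSum hv
    have h3 := norm_nonneg y
    have h4 := norm_nonneg v
    simp only [LinearMap.coprod_apply, Prod.norm_def, max_le_iff] at *
    exact ⟨by linarith, by linarith⟩

theorem isHomogenization_cone₂ : IsHomogenization D.cone₂
    ((coordSum (Fin m)).coprod ((coordSum (Fin p)).coprod LinearMap.id)) where
  closed := by
    have h1 : IsClosed {z : ((Fin m → ℝ) × (Fin p → ℝ) × ℝ) × ℝ | 
        D.Bᵀ *ᵥ z.1.1 + D.Gyᵀ *ᵥ z.1.2.1 ≤ z.1.2.2 • D.d + z.2 • D.cy} :=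
      isClosed_le (by fun_prop) (by fun_prop)
    have h2 : IsClosed {z : ((Fin m → ℝ) × (Fin p → ℝ) × ℝ) × ℝ | 0 ≤ z.1.1} :=
      isClosed_le (by fun_prop) (by fun_prop)
    have h3 : IsClosed {z : ((Fin m → ℝ) × (Fin p → ℝ) × ℝ) × ℝ | 0 ≤ z.1.2.1} :=
      isClosed_le (by fun_prop) (by fun_prop)
    have h4 : IsClosed {z : ((Fin m → ℝ) × (Fin p → ℝ) × ℝ) × ℝ | 0 ≤ z.1.2.2} :=
      isClosed_le (by fun_prop) (by fun_prop)
    have h5 : IsClosed {z : ((Fin m → ℝ) × (Fin p → ℝ) × ℝ) × ℝ | 0 ≤ z.2} :=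
      isClosed_le (by fun_prop) (by fun_prop)
    exact h1.inter (h2.inter (h3.inter (h4.inter h5)))
  height_nonneg := fun _ hz => hz.2.2.2.2
  norm_le := by
    rintro ⟨⟨ψ, u, w⟩, s⟩ ⟨-, hψ, hu, hw, -⟩
    have h1 := norm_le_coordSum hψ
    have h2 := norm_le_coordSum hu
    have h3 := norm_nonneg ψ
    have h4 := norm_nonneg u
    have h5 : |w| = w := abs_of_nonneg hw
    simp only [LinearMap.coprod_apply, Prod.norm_def, max_le_iff, LinearMap.id_apply,
      Real.norm_eq_abs, h5] at *
    exact ⟨by linarith, by linarith, by linarith⟩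

/-- Regrouping of the variables of the Benders subproblem. -/
def regroup : ((Fin m → ℝ) × (Fin p → ℝ) × ℝ × (Fin n₂ → ℝ) × (D.McRow → ℝ)) ≃ₗ[ℝ]
    (((Fin m → ℝ) × (Fin p → ℝ) × ℝ) × ((Fin n₂ → ℝ) × (D.McRow → ℝ))) where
  toFun z := ((z.1, z.2.1, z.2.2.1), z.2.2.2)
  invFun z := (z.1.1, z.1.2.1, z.1.2.2, z.2)
  map_add' _ _ := rfl
  map_smul' _ _ := rfl
  left_inv _ := rfl
  right_inv _ := rfl

theorem dualSet_eq : D.dualSet =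
    D.regroup ⁻¹' heightOne (coupledCone D.cone₁ D.cone₂ (wCoord m p)) := by
  ext ⟨ψ, u, w, y, v⟩
  change (_ ∧ _ ∧ _ ∧ _ ∧ _ ∧ _ ∧ _ ∧ _) ↔
    ((D.Bᵀ *ᵥ ψ + D.Gyᵀ *ᵥ u ≤ w • D.d + (1 : ℝ) • D.cy ∧ 0 ≤ ψ ∧ 0 ≤ u ∧ 0 ≤ w ∧
      (0 : ℝ) ≤ 1) ∧ (w • D.b ≤ D.B *ᵥ y - D.Kpsiᵀ *ᵥ v ∧ D.Ksᵀ *ᵥ v ≤ w • 1 ∧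
    0 ≤ y ∧ 0 ≤ v ∧ 0 ≤ w))
  rw [one_smul]
  have := zero_le_one (α := ℝ)
  tauto

theorem set₁_nonempty (hA : ∀ j : Fin m, ∀ i : Fin n₁, i ∉ D.I → D.A j i = 0)
    (hfeas : D.lowerBoundFeasible.Nonempty) : D.set₁.Nonempty := by
  obtain ⟨⟨x, y⟩, ⟨hx, hxI⟩, hy, -, hb⟩ := hfeas
  simp only at hx hxI hy hb
  -- The multiplier `x i` sits on the row `s ≥ A ψ + hi x - hi`, where `Kpsi` has the entry `-A j i`
  -- and `Ks` has `1`. So `-Kpsiᵀ v` reproduces `A x`, as the omitted columns of `A` are zero, and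
  -- `Ksᵀ v ≤ 1` because the `x i` are binary.
  refine ⟨(y, fun r => if r.1 = 1 then x r.2.2 else 0), ?_, ?_, hy, fun r => ?_⟩
  · convert hb using 1
    rw [add_comm, sub_eq_add_neg]
    congr 1
    ext j
    have hsum : ∑ i, D.A j i * x i = ∑ i : {i // i ∈ D.I}, D.A j i * x i := by
      rw [Finset.sum_coe_sort D.I fun i => D.A j i * x i]
      refine (Finset.sum_subset (Finset.subset_univ _) fun i _ hi => ?_).symm
      rw [hA j i hi, zero_mul]
    simp [mulVec, dotProduct, hsum, Kpsi, Fintype.sum_prod_type, 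
      ← Finset.sum_neg_distrib, Finset.sum_ite_irrel]
  · intro q
    simp [mulVec, dotProduct, Ks, Fintype.sum_prod_type]
    rcases hxI _ q.2.2 with h | h <;> rw [h]
    exact zero_le_one
  · simp only [Pi.zero_apply]
    split_ifs
    exacts [hx _, le_rfl]

/-- With `x` fixed, the relaxation is a feasible bounded linear program in `y`; its dual
multipliers, with `w = 0`, form a point of `P₂`. -/
theorem set₂_nonempty (hfeas : D.lowerBoundFeasible.Nonempty)
    (hbdd : ∃ L : ℝ, ∀ q ∈ D.lowerBoundFeasible, L ≤ D.cx ⬝ᵥ q.1 + D.cy ⬝ᵥ q.2) :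
    D.set₂.Nonempty := by
  obtain ⟨⟨x, y⟩, hx, hy, hG, hb⟩ := hfeas
  obtain ⟨L, hL⟩ := hbdd
  simp only at hx hy hG hb
  let a : Fin p ⊕ Fin m ⊕ Fin n₂ → (Fin n₂ → ℝ) →ₗ[ℝ] ℝ :=
    Sum.elim (fun i => -(LinearMap.proj i ∘ₗ D.Gy.mulVecLin))
      (Sum.elim (fun j => -(LinearMap.proj j ∘ₗ D.B.mulVecLin)) fun k => -LinearMap.proj k)
  have ha : ∀ z, (∀ i, a i z ≤ Sum.elim (-(D.hy - D.Gxy *ᵥ x))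
      (Sum.elim (-(D.b - D.A *ᵥ x)) 0) i) ↔ (x, z) ∈ D.lowerBoundFeasible := by
    intro z
    simp only [Sum.forall, a, Sum.elim_inl, Sum.elim_inr, LinearMap.neg_apply,
      LinearMap.comp_apply, LinearMap.proj_apply, mulVecLin_apply, Pi.neg_apply, neg_le_neg_iff,
      Pi.zero_apply, neg_nonpos, Pi.sub_apply, sub_le_iff_le_add']
    exact ⟨fun h => ⟨hx, h.2.2, h.1, h.2.1⟩, fun h => ⟨h.2.2.1, h.2.2.2, h.2.1⟩⟩
  let g : (Fin n₂ → ℝ) →ₗ[ℝ] ℝ := -dotProductBilin ℝ ℝ D.cy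
  have hg : ∀ z, g z = -(D.cy ⬝ᵥ z) := fun z => rfl
  obtain ⟨l, hl, hgl, -⟩ := affine_farkas a _ g (D.cx ⬝ᵥ x - L)
    ⟨y, (ha y).2 ⟨hx, hy, hG, hb⟩⟩ fun z hz => by
      have := hL _ ((ha z).1 hz)
      simp only [hg] at *
      linarith
  refine ⟨(fun j => l (Sum.inr (Sum.inl j)), fun i => l (Sum.inl i), 0), ?_, fun j => hl _,
    fun i => hl _, le_rfl⟩
  rw [zero_smul, zero_add]
  refine le_of_forall_dotProduct_le fun z hz => ?_
  have h1 := hgl z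
  have h2 : 0 ≤ ∑ k, l (Sum.inr (Sum.inr k)) * z k :=
    Finset.sum_nonneg fun k _ => mul_nonneg (hl _) (hz k)
  simp only [Fintype.sum_sum_type, a, Sum.elim_inl, Sum.elim_inr, LinearMap.neg_apply,
    LinearMap.comp_apply, LinearMap.proj_apply, mulVecLin_apply, mul_neg,
    Finset.sum_neg_distrib, hg] at h1
  rw [dotProduct_add, dotProduct_transpose_mulVec_comm, dotProduct_transpose_mulVec_comm,
    dotProduct_comm z]
  simp only [dotProduct] at *
  linarith

end Bilevel

/-! ### Linear programming duality for the subproblem -/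

namespace Bilevel

variable {n₁ n₂ m p : ℕ} (D : Bilevel n₁ n₂ m p)

/-- The objective of the Benders subproblem at `x`, in the regrouped variables. -/
noncomputable def subObj (x : Fin n₁ → ℝ) :
    (((Fin m → ℝ) × (Fin p → ℝ) × ℝ) × ((Fin n₂ → ℝ) × (D.McRow → ℝ))) →ₗ[ℝ] ℝ where
  toFun z := D.obj₂ x z.1.1 z.1.2.1 - D.obj₁ x z.2.1 z.2.2
  map_add' z z' := by
    simp only [obj₁, obj₂, Prod.fst_add, Prod.snd_add, add_dotProduct, dotProduct_add]
    ring
  map_smul' c z := by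
    simp only [obj₁, obj₂, Prod.smul_fst, Prod.smul_snd, smul_dotProduct, dotProduct_smul,
      smul_eq_mul, RingHom.id_apply]
    ring

theorem subObj_apply (x : Fin n₁ → ℝ) (ψ : Fin m → ℝ) (u : Fin p → ℝ) (w : ℝ) (y : Fin n₂ → ℝ)
    (v : D.McRow → ℝ) :
    D.subObj x ((ψ, u, w), (y, v)) = D.obj₂ x ψ u - D.obj₁ x y v := rfl

theorem obj₁_smul (x : Fin n₁ → ℝ) (w : ℝ) (y : Fin n₂ → ℝ) (v : D.McRow → ℝ) :
    D.obj₁ x (w • y) (w • v) = w * D.obj₁ x y v := by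
  simp only [obj₁, dotProduct_smul, smul_dotProduct, smul_eq_mul]
  ring

theorem obj₁_zero (x : Fin n₁ → ℝ) : D.obj₁ x 0 0 = 0 := by simp [obj₁]

theorem obj₂_zero (x : Fin n₁ → ℝ) : D.obj₂ x 0 0 = 0 := by simp [obj₂]

theorem mem_heightOne_coupled {ψ : Fin m → ℝ} {u : Fin p → ℝ} {w : ℝ} {y : Fin n₂ → ℝ}
    {v : D.McRow → ℝ} :
    ((ψ, u, w), (y, v)) ∈ heightOne (coupledCone D.cone₁ D.cone₂ (wCoord m p)) ↔
      (ψ, u, w, y, v) ∈ D.dualSet := by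
  rw [dualSet_eq]
  rfl

theorem weak_duality {x : Fin n₁ → ℝ} {z : (Fin n₂ → ℝ) × (Fin m → ℝ) × (D.Pair → ℝ)}
    (hz : z ∈ D.inner x) {q : ((Fin m → ℝ) × (Fin p → ℝ) × ℝ) × ((Fin n₂ → ℝ) × (D.McRow → ℝ))}
    (hq : q ∈ heightOne (coupledCone D.cone₁ D.cone₂ (wCoord m p))) :
    D.subObj x q ≤ D.cy ⬝ᵥ z.1 := by
  obtain ⟨y, ψ, s⟩ := z
  obtain ⟨⟨ψ', u, w⟩, y', v⟩ := q
  obtain ⟨h1, h2, hy, h3, hψ, h4, h5, hs⟩ := hz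
  obtain ⟨d1, d2, d3, hψ', hu, hw, hy', hv⟩ := D.mem_heightOne_coupled.1 hq
  have p1 := dotProduct_le_dotProduct_of_nonneg_left h1 hu
  have p2 := dotProduct_le_dotProduct_of_nonneg_left h2 hψ'
  have p3 := dotProduct_le_dotProduct_of_nonneg_left h3 hy'
  have p4 := mul_nonneg hw h4
  have p5 := dotProduct_le_dotProduct_of_nonneg_left h5 hv
  have q1 := dotProduct_le_dotProduct_of_nonneg_left d1 hψ
  have q2 := dotProduct_le_dotProduct_of_nonneg_left d2 hy
  have q3 := dotProduct_le_dotProduct_of_nonneg_left d3 hs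
  rw [subObj_apply, obj₁, obj₂]
  simp only [dotProduct_add, dotProduct_sub, dotProduct_smul, dotProduct_neg,
    dotProduct_transpose_mulVec_comm, smul_eq_mul, mul_add, mul_sub, mul_neg] at *
  rw [← mulVec_transpose, dotProduct_transpose_mulVec_comm] at p3
  rw [dotProduct_comm D.d y'] at *
  rw [dotProduct_comm D.d y] at p4
  rw [dotProduct_comm D.cy y]
  linarith

theorem strong_duality {x : Fin n₁ → ℝ} {t : ℝ}
    (hne : (heightOne (coupledCone D.cone₁ D.cone₂ (wCoord m p))).Nonempty)
    (h : ∀ q ∈ heightOne (coupledCone D.cone₁ D.cone₂ (wCoord m p)), D.subObj x q ≤ t) :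
    ∃ z ∈ D.inner x, D.cy ⬝ᵥ z.1 ≤ t := by
  classical
  let V := ((Fin m → ℝ) × (Fin p → ℝ) × ℝ) × ((Fin n₂ → ℝ) × (D.McRow → ℝ))
  let πψ : V →ₗ[ℝ] (Fin m → ℝ) := LinearMap.fst ℝ _ _ ∘ₗ LinearMap.fst ℝ _ _
  let πu : V →ₗ[ℝ] (Fin p → ℝ) := LinearMap.fst ℝ _ _ ∘ₗ LinearMap.snd ℝ _ _ ∘ₗ LinearMap.fst ℝ _ _
  let πw : V →ₗ[ℝ] ℝ := LinearMap.snd ℝ _ _ ∘ₗ LinearMap.snd ℝ _ _ ∘ₗ LinearMap.fst ℝ _ _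
  let πy : V →ₗ[ℝ] (Fin n₂ → ℝ) := LinearMap.fst ℝ _ _ ∘ₗ LinearMap.snd ℝ _ _
  let πv : V →ₗ[ℝ] (D.McRow → ℝ) := LinearMap.snd ℝ _ _ ∘ₗ LinearMap.snd ℝ _ _
  let F₁ : V →ₗ[ℝ] (Fin n₂ → ℝ) :=
    D.Bᵀ.mulVecLin ∘ₗ πψ + D.Gyᵀ.mulVecLin ∘ₗ πu - πw.smulRight D.d
  let F₂ : V →ₗ[ℝ] (Fin m → ℝ) :=
    πw.smulRight D.b - (D.B.mulVecLin ∘ₗ πy - D.Kpsiᵀ.mulVecLin ∘ₗ πv)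
  let F₃ : V →ₗ[ℝ] (D.Pair → ℝ) := D.Ksᵀ.mulVecLin ∘ₗ πv - πw.smulRight 1
  let a : (Fin n₂ ⊕ Fin m ⊕ D.Pair) ⊕ (Fin m ⊕ Fin p ⊕ Unit ⊕ Fin n₂ ⊕ D.McRow) → V →ₗ[ℝ] ℝ :=
    Sum.elim
      (Sum.elim (fun k => LinearMap.proj k ∘ₗ F₁)
        (Sum.elim (fun j => LinearMap.proj j ∘ₗ F₂) fun q => LinearMap.proj q ∘ₗ F₃))
      (Sum.elim (fun j => -(LinearMap.proj j ∘ₗ πψ)) (Sum.elim (fun i => -(LinearMap.proj i ∘ₗ πu))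
        (Sum.elim (fun _ => -πw) (Sum.elim (fun k => -(LinearMap.proj k ∘ₗ πy))
          fun r => -(LinearMap.proj r ∘ₗ πv)))))
  have ha : ∀ z : V, (∀ i, a i z ≤ Sum.elim (Sum.elim D.cy 0) 0 i) ↔
      z ∈ heightOne (coupledCone D.cone₁ D.cone₂ (wCoord m p)) := by
    rintro ⟨⟨ψ, u, w⟩, y, v⟩
    rw [mem_heightOne_coupled]
    simp only [Sum.forall, a, Sum.elim_inl, Sum.elim_inr, LinearMap.neg_apply,
      LinearMap.comp_apply, LinearMap.proj_apply, Pi.zero_apply, neg_nonpos, F₁, F₂, F₃,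
      LinearMap.sub_apply, LinearMap.add_apply, LinearMap.smulRight_apply, mulVecLin_apply, πψ, πu,
      πw, πy, πv, LinearMap.fst_apply, LinearMap.snd_apply, Pi.sub_apply,
      sub_le_iff_le_add', add_zero]
    constructor
    · rintro ⟨⟨h1, h2, h3⟩, h4, h5, h6, h7, h8⟩
      exact ⟨h2, h1, h3, h4, h5, h6 (), h7, h8⟩
    · rintro ⟨h1, h2, h3, h4, h5, h6, h7, h8⟩
      exact ⟨⟨h2, h1, h3⟩, h4, h5, fun _ => h6, h7, h8⟩
  obtain ⟨z₀, hz₀⟩ := hne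
  -- The multipliers of the three structural blocks of `P` are the primal point `(y, ψ, s)`.
  obtain ⟨l, hl, hg, ht⟩ := affine_farkas a _ (D.subObj x) t ⟨z₀, (ha z₀).2 hz₀⟩
    fun z hz => h z ((ha z).1 hz)
  obtain ⟨y, hy⟩ : ∃ y : Fin n₂ → ℝ, y = fun k => l (Sum.inl (Sum.inl k)) := ⟨_, rfl⟩
  obtain ⟨ψ, hψ⟩ : ∃ ψ : Fin m → ℝ, ψ = fun j => l (Sum.inl (Sum.inr (Sum.inl j))) := ⟨_, rfl⟩
  obtain ⟨s, hs⟩ : ∃ s : D.Pair → ℝ, s = fun q => l (Sum.inl (Sum.inr (Sum.inr q))) := ⟨_, rfl⟩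
  -- The sign constraints contribute nonpositively, so dropping them leaves an inequality on the
  -- nonnegative orthant. Testing it on one block at a time gives the constraints of the inner
  -- problem.
  have key : ∀ (ψ' : Fin m → ℝ) (u : Fin p → ℝ) (w : ℝ) (y' : Fin n₂ → ℝ) (v : D.McRow → ℝ),
      0 ≤ ψ' → 0 ≤ u → 0 ≤ w → 0 ≤ y' → 0 ≤ v →
      D.obj₂ x ψ' u - D.obj₁ x y' v ≤ y ⬝ᵥ (D.Bᵀ *ᵥ ψ' + D.Gyᵀ *ᵥ u - w • D.d) +
        (ψ ⬝ᵥ (w • D.b - (D.B *ᵥ y' - D.Kpsiᵀ *ᵥ v)) + s ⬝ᵥ (D.Ksᵀ *ᵥ v - w • 1)) := by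
    intro ψ' u w y' v h1 h2 h3 h4 h5
    have hgz := hg ((ψ', u, w), (y', v))
    rw [Fintype.sum_sum_type] at hgz
    have hsign : ∑ i, l (Sum.inr i) * a (Sum.inr i) ((ψ', u, w), (y', v)) ≤ 0 := by
      refine Finset.sum_nonpos fun i _ => mul_nonpos_of_nonneg_of_nonpos (hl _) ?_
      have : ∀ i, 0 ≤ -(a (Sum.inr i) ((ψ', u, w), (y', v))) := by
        simp only [Sum.forall, a, Sum.elim_inl, Sum.elim_inr, LinearMap.neg_apply, neg_neg]
        exact ⟨h1, h2, fun _ => h3, h4, h5⟩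
      exact neg_nonneg.1 (this i)
    have hmain : ∑ i, l (Sum.inl i) * a (Sum.inl i) ((ψ', u, w), (y', v)) =
        y ⬝ᵥ (D.Bᵀ *ᵥ ψ' + D.Gyᵀ *ᵥ u - w • D.d) +
        (ψ ⬝ᵥ (w • D.b - (D.B *ᵥ y' - D.Kpsiᵀ *ᵥ v)) + s ⬝ᵥ (D.Ksᵀ *ᵥ v - w • 1)) := by
      rw [Fintype.sum_sum_type, Fintype.sum_sum_type, hy, hψ, hs]
      rfl
    rw [← D.subObj_apply x ψ' u w y' v, hgz, hmain]
    linarith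
  simp only [obj₁, obj₂, dotProduct_add, dotProduct_sub, dotProduct_smul, smul_eq_mul,
    dotProduct_transpose_mulVec_comm] at key
  refine ⟨(y, ψ, s), ⟨?_, ?_, ?_, ?_, ?_, ?_, ?_, ?_⟩, ?_⟩
  · refine le_of_forall_dotProduct_le fun u hu => ?_
    have := key 0 u 0 0 0 le_rfl hu le_rfl le_rfl le_rfl
    simp only [zero_dotProduct, mulVec_zero, dotProduct_zero] at this
    simp only [dotProduct_sub]
    linarith
  · refine le_of_forall_dotProduct_le fun ψ' hψ' => ?_
    have := key ψ' 0 0 0 0 hψ' le_rfl le_rfl le_rfl le_rfl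
    simp only [zero_dotProduct, mulVec_zero, dotProduct_zero] at this
    simp only [dotProduct_sub]
    linarith
  · rw [hy]; exact fun k => hl _
  · refine le_of_forall_dotProduct_le fun y' hy' => ?_
    have := key 0 0 0 y' 0 le_rfl le_rfl le_rfl hy' le_rfl
    simp only [zero_dotProduct] at this
    rw [dotProduct_neg, dotProduct_neg, ← mulVec_transpose, dotProduct_transpose_mulVec_comm,
      dotProduct_comm y']
    linarith
  · rw [hψ]; exact fun j => hl _
  · have := key 0 0 1 0 0 le_rfl le_rfl zero_le_one le_rfl le_rfl
    simp only [zero_dotProduct, mulVec_zero, dotProduct_zero] at this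
    rw [dotProduct_comm D.d]
    linarith
  · refine le_of_forall_dotProduct_le fun v hv => ?_
    have := key 0 0 0 0 v le_rfl le_rfl le_rfl le_rfl hv
    simp only [zero_dotProduct, mulVec_zero, dotProduct_zero] at this
    simp only [dotProduct_add]
    linarith
  · rw [hs]; exact fun q => hl _
  -- Only the first block has a nonzero right-hand side, namely `cy`.
  · rw [Fintype.sum_sum_type, Fintype.sum_sum_type] at ht
    have e : ∑ k, l (Sum.inl (Sum.inl k)) * D.cy k = D.cy ⬝ᵥ y := by rw [dotProduct_comm, hy]; rfl
    simpa [e] using ht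

theorem f_le_coe_iff {x : Fin n₁ → ℝ} {t : ℝ}
    (hne : (heightOne (coupledCone D.cone₁ D.cone₂ (wCoord m p))).Nonempty) :
    D.f x ≤ (t : EReal) ↔
      ∀ q ∈ heightOne (coupledCone D.cone₁ D.cone₂ (wCoord m p)), D.subObj x q ≤ t := by
  refine ⟨fun h q hq => ?_, fun h => ?_⟩
  · have : ((D.subObj x q : ℝ) : EReal) ≤ D.f x :=
      le_iInf₂ fun z hz => EReal.coe_le_coe_iff.2 (D.weak_duality hz hq)
    exact EReal.coe_le_coe_iff.1 (this.trans h)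
  · obtain ⟨z, hz, hzt⟩ := D.strong_duality hne h
    exact (iInf₂_le z hz).trans (EReal.coe_le_coe_iff.2 hzt)

theorem f_ne_bot {x : Fin n₁ → ℝ}
    (hne : (heightOne (coupledCone D.cone₁ D.cone₂ (wCoord m p))).Nonempty) : D.f x ≠ ⊥ := by
  obtain ⟨q, hq⟩ := hne
  have : ((D.subObj x q : ℝ) : EReal) ≤ D.f x :=
    le_iInf₂ fun z hz => EReal.coe_le_coe_iff.2 (D.weak_duality hz hq)
  exact ((EReal.bot_lt_coe _).trans_le this).ne'

theorem f_attained {x : Fin n₁ → ℝ}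
    (hne : (heightOne (coupledCone D.cone₁ D.cone₂ (wCoord m p))).Nonempty) (hx : D.f x ≠ ⊤) :
    ∃ z ∈ D.inner x, D.f x = ((D.cy ⬝ᵥ z.1 : ℝ) : EReal) := by
  have hr := EReal.coe_toReal hx (D.f_ne_bot hne)
  obtain ⟨z, hz, hzt⟩ := D.strong_duality hne ((D.f_le_coe_iff hne).1 hr.ge)
  refine ⟨z, hz, le_antisymm (iInf₂_le z hz) ?_⟩
  rw [← hr]
  exact EReal.coe_le_coe_iff.2 hzt

/-! ### Master constraints, extreme points and extreme rays -/

theorem extremePoints_coupled (ne₁ : D.set₁.Nonempty) :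
    (heightOne (coupledCone D.cone₁ D.cone₂ (wCoord m p))).extremePoints ℝ =
      {z | ∃ a ∈ D.J₂, ∃ q ∈ D.J₁, z = (a, wCoord m p a • q)} := by
  rw [extremePoints_coupledCone D.isHomogenization_cone₁ D.wCoord_nonneg
    (by rwa [heightOne_cone₁]), heightOne_cone₁, heightOne_cone₂]
  rfl

theorem extremeRays_coupled (ne₁ : D.set₁.Nonempty) (ne₂ : D.set₂.Nonempty) :
    extremeRays (heightOne (coupledCone D.cone₁ D.cone₂ (wCoord m p))) =
      {z | ∃ q ∈ D.R₁, z = (0, q)} ∪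
      {z | ∃ a ∈ D.R₂, wCoord m p a = 0 ∧ z = (a, 0)} ∪
      {z | ∃ q ∈ D.J₁, ∃ a ∈ D.R₂, 0 < wCoord m p a ∧ z = (a, wCoord m p a • q)} := by
  rw [extremeRays_coupledCone D.isHomogenization_cone₁ D.isHomogenization_cone₂ D.wCoord_nonneg
    (by rwa [heightOne_cone₁]) (by rwa [heightOne_cone₂]), heightOne_cone₁, heightOne_cone₂]
  rfl

theorem mem_master_iff (ne₁ : D.set₁.Nonempty) (ne₂ : D.set₂.Nonempty) (x : Fin n₁ → ℝ) (t : ℝ) :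
    (x, t) ∈ D.master ↔ x ∈ D.X ∧ D.f x ≤ (t : EReal) := by
  have hne : (heightOne (coupledCone D.cone₁ D.cone₂ (wCoord m p))).Nonempty :=
    heightOne_coupledCone_nonempty D.wCoord_nonneg (by rwa [heightOne_cone₁])
      (by rwa [heightOne_cone₂])
  rw [D.f_le_coe_iff hne,
    (D.isHomogenization_cone₁.coupledCone D.isHomogenization_cone₂).forall_le_iff hne, D.extremePoints_coupled ne₁, D.extremeRays_coupled ne₁ ne₂]
  refine and_congr_right fun _ => and_congr ⟨?_, ?_⟩ ⟨?_, ?_⟩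
  · rintro h _ ⟨⟨ψ, u, w⟩, h₂, ⟨y, v⟩, h₁, rfl⟩
    rw [wCoord_apply, Prod.smul_mk, subObj_apply, obj₁_smul]
    exact h ψ u w h₂ y v h₁
  · intro h ψ u w h₂ y v h₁
    have := h _ ⟨_, h₂, _, h₁, rfl⟩
    rwa [wCoord_apply, Prod.smul_mk, subObj_apply, obj₁_smul] at this
  · rintro ⟨hr₁, hr₂, hr₃⟩ _ ((⟨⟨y, v⟩, h, rfl⟩ | ⟨⟨ψ, u, w⟩, h, hw, rfl⟩) |
      ⟨⟨y, v⟩, h, ⟨ψ, u, w⟩, h', hw, rfl⟩)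
    · have := hr₁ y v h
      change D.obj₂ x 0 0 - D.obj₁ x y v ≤ 0
      rw [obj₂_zero]
      linarith
    · rw [wCoord_apply] at hw
      subst hw
      change D.obj₂ x ψ u - D.obj₁ x 0 0 ≤ 0
      rw [obj₁_zero, sub_zero]
      exact hr₂ ψ u h
    · rw [wCoord_apply, Prod.smul_mk, subObj_apply, obj₁_smul]
      exact hr₃ y v h ψ u w h' hw
  · refine fun h => ⟨fun y v hr => ?_, fun ψ u hr => ?_, fun y v h₁ ψ u w hr hw => ?_⟩
    · have : D.obj₂ x 0 0 - D.obj₁ x y v ≤ 0 := h _ (Or.inl (Or.inl ⟨_, hr, rfl⟩))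
      rw [obj₂_zero] at this
      linarith
    · have : D.obj₂ x ψ u - D.obj₁ x 0 0 ≤ 0 := h _ (Or.inl (Or.inr ⟨_, hr, rfl, rfl⟩))
      rwa [obj₁_zero, sub_zero] at this
    · have := h _ (Or.inr ⟨_, h₁, _, hr, hw, rfl⟩)
      rwa [wCoord_apply, Prod.smul_mk, subObj_apply, obj₁_smul] at this

theorem extremePoints_dualSet (ne₁ : D.set₁.Nonempty) :
    D.dualSet.extremePoints ℝ =
      {μ | ∃ ψ u w y v, (ψ, u, w) ∈ D.J₂ ∧ (y, v) ∈ D.J₁ ∧ μ = (ψ, u, w, w • y, w • v)} := by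
  rw [dualSet_eq, extremePoints_preimage, D.extremePoints_coupled ne₁]
  ext μ
  constructor
  · rintro ⟨⟨ψ, u, w⟩, h₂, ⟨y, v⟩, h₁, e⟩
    exact ⟨ψ, u, w, y, v, h₂, h₁, D.regroup.injective e⟩
  · rintro ⟨ψ, u, w, y, v, h₂, h₁, rfl⟩
    exact ⟨(ψ, u, w), h₂, (y, v), h₁, rfl⟩

theorem extremeRays_dualSet (ne₁ : D.set₁.Nonempty) (ne₂ : D.set₂.Nonempty) :
    extremeRays D.dualSet =
      {μ | ∃ y v, (y, v) ∈ D.R₁ ∧ μ = (0, 0, 0, y, v)} ∪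
      {μ | ∃ ψ u, (ψ, u, (0 : ℝ)) ∈ D.R₂ ∧ μ = (ψ, u, 0, 0, 0)} ∪
      {μ | ∃ y v ψ u w, (y, v) ∈ D.J₁ ∧ (ψ, u, w) ∈ D.R₂ ∧ 0 < w ∧
        μ = (ψ, u, w, w • y, w • v)} := by
  rw [dualSet_eq, extremeRays_preimage, D.extremeRays_coupled ne₁ ne₂]
  ext μ
  constructor
  · rintro ((⟨⟨y, v⟩, h, e⟩ | ⟨⟨ψ, u, w⟩, h, hw, e⟩) | ⟨⟨y, v⟩, h, ⟨ψ, u, w⟩, h', hw, e⟩)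
    · exact Or.inl (Or.inl ⟨y, v, h, D.regroup.injective e⟩)
    · rw [wCoord_apply] at hw
      subst hw
      exact Or.inl (Or.inr ⟨ψ, u, h, D.regroup.injective e⟩)
    · exact Or.inr ⟨y, v, ψ, u, w, h, h', hw, D.regroup.injective e⟩
  · rintro ((⟨y, v, h, rfl⟩ | ⟨ψ, u, h, rfl⟩) | ⟨y, v, ψ, u, w, h, h', hw, rfl⟩)
    · exact Or.inl (Or.inl ⟨(y, v), h, rfl⟩)
    · exact Or.inl (Or.inr ⟨(ψ, u, 0), h, rfl, rfl⟩)
    · exact Or.inr ⟨(y, v), h, (ψ, u, w), h', hw, rfl⟩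

/-! ### Optimal values and optimal solutions -/

/-- The master problem is the epigraph form, so `t = f x` is the best choice. This is a real number
unless `f x = ⊤`, in which case `x` contributes nothing to the infimum. -/
theorem iInf_mipObj_eq
    (hmaster : ∀ (x : Fin n₁ → ℝ) (t : ℝ), (x, t) ∈ D.master ↔ x ∈ D.X ∧ D.f x ≤ (t : EReal))
    (hbot : ∀ x, D.f x ≠ ⊥) :
    (⨅ x ∈ D.X, D.mipObj x) = (⨅ q ∈ D.master, ((D.cx ⬝ᵥ q.1 + q.2 : ℝ) : EReal)) := by
  refine le_antisymm (le_iInf₂ ?_) (le_iInf₂ fun x hx => ?_)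
  · rintro ⟨x, t⟩ hq
    obtain ⟨hx, hf⟩ := (hmaster x t).1 hq
    refine (iInf₂_le x hx).trans ?_
    rw [EReal.coe_add]
    exact add_le_add_right hf _
  · by_cases htop : D.f x = ⊤
    · rw [mipObj, htop, EReal.coe_add_top]
      exact le_top
    · have hr := EReal.coe_toReal htop (hbot x)
      refine (iInf₂_le (x, (D.f x).toReal) ((hmaster x _).2 ⟨hx, hr.ge⟩)).trans ?_
      rw [EReal.coe_add, mipObj]
      exact (congrArg _ hr).le

theorem optimal_master_iff
    (hmaster : ∀ (x : Fin n₁ → ℝ) (t : ℝ), (x, t) ∈ D.master ↔ x ∈ D.X ∧ D.f x ≤ (t : EReal))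
    (hbot : ∀ x, D.f x ≠ ⊥) (x : Fin n₁ → ℝ) (t : ℝ) :
    ((x, t) ∈ D.master ∧ ∀ q ∈ D.master, D.cx ⬝ᵥ x + t ≤ D.cx ⬝ᵥ q.1 + q.2) ↔
      (x ∈ D.X ∧ D.f x = (t : EReal) ∧ ∀ x' ∈ D.X, D.mipObj x ≤ D.mipObj x') := by
  constructor
  · rintro ⟨hxt, hopt⟩
    obtain ⟨hx, hf⟩ := (hmaster x t).1 hxt
    have hr := EReal.coe_toReal (ne_top_of_le_ne_top (EReal.coe_ne_top t) hf) (hbot x)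
    have hfx : D.f x = t := by
      refine le_antisymm hf ?_
      have := hopt _ ((hmaster x _).2 ⟨hx, hr.ge⟩)
      rw [← hr]
      exact EReal.coe_le_coe_iff.2 (by simpa using this)
    refine ⟨hx, hfx, fun x' hx' => ?_⟩
    by_cases htop : D.f x' = ⊤
    · rw [mipObj, mipObj, htop, EReal.coe_add_top]
      exact le_top
    · have hr' := EReal.coe_toReal htop (hbot x')
      have := hopt _ ((hmaster x' _).2 ⟨hx', hr'.ge⟩)
      rw [mipObj, mipObj, hfx, ← hr', ← EReal.coe_add, ← EReal.coe_add]
      exact EReal.coe_le_coe_iff.2 this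
  · rintro ⟨hx, hfx, hopt⟩
    refine ⟨(hmaster x t).2 ⟨hx, hfx.le⟩, ?_⟩
    rintro ⟨x', t'⟩ hq
    obtain ⟨hx', hf'⟩ := (hmaster x' t').1 hq
    have h1 : D.mipObj x ≤ ((D.cx ⬝ᵥ x' + t' : ℝ) : EReal) := by
      rw [EReal.coe_add]
      exact (hopt x' hx').trans (add_le_add_right hf' _)
    rw [mipObj, hfx, ← EReal.coe_add] at h1
    exact EReal.coe_le_coe_iff.1 h1

end Bilevel

theorem corollary1 {n₁ n₂ m p : ℕ} (D : Bilevel n₁ n₂ m p)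
    -- the follower is not affected by the continuous leader variables
    (hA : ∀ j : Fin m, ∀ i : Fin n₁, i ∉ D.I → D.A j i = 0)
    -- the lower bounding problem is feasible and bounded
    (hfeas : D.lowerBoundFeasible.Nonempty)
    (hbdd : ∃ L : ℝ, ∀ q ∈ D.lowerBoundFeasible, L ≤ D.cx ⬝ᵥ q.1 + D.cy ⬝ᵥ q.2) :
    -- the master problem is the epigraph form of (MIP) over `𝒳`, and `f` is a minimum
    (∀ (x : Fin n₁ → ℝ) (t : ℝ), (x, t) ∈ D.master ↔ x ∈ D.X ∧ D.f x ≤ (t : EReal)) ∧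
    (∀ x ∈ D.X, D.f x ≠ ⊤ → ∃ z ∈ D.inner x, D.f x = ((D.cy ⬝ᵥ z.1 : ℝ) : EReal)) ∧
    -- the two problems have the same optimal value
    (⨅ x ∈ D.X, D.mipObj x) = (⨅ q ∈ D.master, ((D.cx ⬝ᵥ q.1 + q.2 : ℝ) : EReal)) ∧
    -- the two problems have the same optimal solutions
    (∀ (x : Fin n₁ → ℝ) (t : ℝ),
      ((x, t) ∈ D.master ∧ ∀ q ∈ D.master, D.cx ⬝ᵥ x + t ≤ D.cx ⬝ᵥ q.1 + q.2) ↔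
      (x ∈ D.X ∧ D.f x = (t : EReal) ∧ ∀ x' ∈ D.X, D.mipObj x ≤ D.mipObj x')) ∧
    -- the extreme points of the Benders subproblem
    D.dualSet.extremePoints ℝ =
      {μ | ∃ ψ u w y v, (ψ, u, w) ∈ D.J₂ ∧ (y, v) ∈ D.J₁ ∧ μ = (ψ, u, w, w • y, w • v)} ∧
    -- the extreme rays of the Benders subproblem
    extremeRays D.dualSet =
      {μ | ∃ y v, (y, v) ∈ D.R₁ ∧ μ = (0, 0, 0, y, v)} ∪
      {μ | ∃ ψ u, (ψ, u, (0 : ℝ)) ∈ D.R₂ ∧ μ = (ψ, u, 0, 0, 0)} ∪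
      {μ | ∃ y v ψ u w, (y, v) ∈ D.J₁ ∧ (ψ, u, w) ∈ D.R₂ ∧ 0 < w ∧
        μ = (ψ, u, w, w • y, w • v)} := by
  have ne₁ := D.set₁_nonempty hA hfeas
  have ne₂ := D.set₂_nonempty hfeas hbdd
  have hne : (heightOne (coupledCone D.cone₁ D.cone₂ (Bilevel.wCoord m p))).Nonempty :=
    heightOne_coupledCone_nonempty D.wCoord_nonneg (by rwa [D.heightOne_cone₁])
      (by rwa [D.heightOne_cone₂])
  have hmaster := D.mem_master_iff ne₁ ne₂
  have hbot : ∀ x, D.f x ≠ ⊥ := fun x => D.f_ne_bot hne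
  exact ⟨hmaster, fun x _ hx => D.f_attained hne hx, D.iInf_mipObj_eq hmaster hbot,
    D.optimal_master_iff hmaster hbot, D.extremePoints_dualSet ne₁, D.extremeRays_dualSet ne₁ ne₂⟩
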